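/- Let $X$ be a real Banach space (complex Banach spaces are regarded as real ones), let $M$ be a bounded linear operator on $X$ (such an operator is sectorial, and $-M$ generates the analytic semigroup $e^{-tM}=\sum_{k\ge 0}(-tM)^k/k!$), let $f:X\to X$, and let $y:[t_0,t_{\rm end}]\to X$ be a solution of $$y'(t)+My(t)=f(y(t)),\qquad t\in[t_0,t_{\rm end}].$$ A four-stage explicit SVERK method with real coefficients $a_{ij}$ ($1\le j<i\le 4$), $b_i$ and nodes $c_i=\sum_{j<i}a_{ij}$ computes, with step size $h>0$ and $y_0=y(t_0)$, from $y_n$ the stages and the update $$Y_i=e^{-c_ihM}y_n+h\sum_{j<i}a_{ij}f(Y_j)\quad(i=1,\dots,4),\qquad y_{n+1}=e^{-hM}y_n+h\sum_{i=1}^4 b_if(Y_i)+\bar w_4(hM),$$ where, with $F=f(y_n)$, $J=f'(y_n)$, $H=f''(y_n)$ (real Fréchet derivatives) and $g=-My_n+F$, $$\bar w_4(hM)=-\tfrac{h^2}{2!}MF+\tfrac{h^3}{3!}\big(M^2F-MJg-JMF\big)+\tfrac{h^4}{4!}\big(-M^3F+M^2Jg-MH(g,g)-MJ(M^2y_n-MF+Jg)+JM^2F-JJMF-JMJg+3H(-MF,g)\big).$$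 Suppose that the coefficients satisfy the classical fourth-order Runge--Kutta conditions $$\sum_i b_i=1,\quad \sum_i b_ic_i=\tfrac12,\quad \sum_i b_ic_i^2=\tfrac13,\quad \sum_{i,j} b_ia_{ij}c_j=\tfrac16,$$ $$\sum_i b_ic_i^3=\tfrac14,\quad \sum_{i,j} b_ic_ia_{ij}c_j=\tfrac18,\quad \sum_{i,j} b_ia_{ij}c_j^2=\tfrac1{12},\quad \sum_{i,j,k} b_ia_{ij}a_{jk}c_k=\tfrac1{24}.$$ Put $t_n=t_0+nh$. For $\rho>0$ let the strip of radius $\rho$ along $y$ be the union of the open balls $B(y(t),\rho)$, $t\in[t_0,t_{\rm end}]$. Then the following hold. (1) Given real numbers $T,K,L,R,B$ and $\rho>0$, there are constants $C$ and $h_0>0$, depending only on these numbers and on the coefficients of the method, such that the following holds for all $X,M,f,y,t_0,t_{\rm end}$ as above with $t_{\rm end}-t_0=T$. If $\|M\|\le K$; $\|y(t)\|\le R$ on $[t_0,t_{\rm end}]$; $\|f(v)-f(w)\|\le L\|v-w\|$ for all $t\in[t_0,t_{\rm end}]$ and $v,w\in B(y(t),\rho)$; and $f$ is of class $C^5$ in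 the strip of radius $\rho$ along $y$ with $\|f^{(p)}\|\le B$ there for $p=0,\dots,5$, then $$\|y_n-y(t_n)\|\le Ch^4\qquad\text{for all } 0<h\le h_0 \text{ and all integers } 1\le n\le \frac{t_{\rm end}-t_0}{h}.$$ (2) For all $X,M,f,y,t_0,t_{\rm end}$ as above for which $f$ is of class $C^5$ on all of $X$, there is a constant $C$, independent of $n$ and $h$, such that $\|y_n-y(t_n)\|\le Ch^4$ for all $h>0$ and all integers $1\le n\le (t_{\rm end}-t_0)/h$, without any restriction on the step size. -/

import Mathlib

universe u

/-- The real coefficients `a_{ij}` (`1 ≤ j < i ≤ 4`) and `b_i` of an explicit four-stage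
scheme. -/
structure SVERK4 where
  a21 : ℝ
  a31 : ℝ
  a32 : ℝ
  a41 : ℝ
  a42 : ℝ
  a43 : ℝ
  b1 : ℝ
  b2 : ℝ
  b3 : ℝ
  b4 : ℝ

namespace SVERK4

/-- The node `c_2`, a row sum of the coefficient matrix (`c_1 = 0`). -/
def c2 (m : SVERK4) : ℝ := m.a21

/-- The node `c_3`. -/
def c3 (m : SVERK4) : ℝ := m.a31 + m.a32

/-- The node `c_4`. -/
def c4 (m : SVERK4) : ℝ := m.a41 + m.a42 + m.a43

/-- The eight classical order conditions of fourth-order explicit Runge-Kutta methods with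
four stages. -/
structure OrderConditions (m : SVERK4) : Prop where
  quadrature : m.b1 + m.b2 + m.b3 + m.b4 = 1
  bc : m.b2 * m.c2 + m.b3 * m.c3 + m.b4 * m.c4 = 1 / 2
  bc_sq : m.b2 * m.c2 ^ 2 + m.b3 * m.c3 ^ 2 + m.b4 * m.c4 ^ 2 = 1 / 3
  bac : m.b3 * m.a32 * m.c2 + m.b4 * m.a42 * m.c2 + m.b4 * m.a43 * m.c3 = 1 / 6
  bc_cube : m.b2 * m.c2 ^ 3 + m.b3 * m.c3 ^ 3 + m.b4 * m.c4 ^ 3 = 1 / 4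
  bcac : m.b3 * m.c3 * m.a32 * m.c2 + m.b4 * m.c4 * m.a42 * m.c2
    + m.b4 * m.c4 * m.a43 * m.c3 = 1 / 8
  bac_sq : m.b3 * m.a32 * m.c2 ^ 2 + m.b4 * m.a42 * m.c2 ^ 2
    + m.b4 * m.a43 * m.c3 ^ 2 = 1 / 12
  baac : m.b4 * m.a43 * m.a32 * m.c2 = 1 / 24

end SVERK4

section Scheme

variable {X : Type u} [NormedAddCommGroup X] [NormedSpace ℝ X]

/-- `e^{-tM}` for a bounded operator `M`, by the exponential series. -/
noncomputable def expNeg (M : X →L[ℝ] X) (t : ℝ) : X →L[ℝ] X :=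
  NormedSpace.exp ((-t) • M)

/-- The correction term `w₄(hM)` of the four-stage SVERK scheme, evaluated at `x`. Here `F`, `J`,
`H` are the value and the first two (Fréchet) derivatives of `f` at `x`, and `g = -Mx + f(x)`. -/
noncomputable def sverkW4 (M : X →L[ℝ] X) (f : X → X) (h : ℝ) (x : X) : X :=
  let F : X := f x
  let J : X →L[ℝ] X := fderiv ℝ f x
  let H : X →L[ℝ] X →L[ℝ] X := fderiv ℝ (fderiv ℝ f) x
  let g : X := -(M x) + F;
  -((h ^ 2 / 2) • M F)
    + (h ^ 3 / 6) • (M (M F) - M (J g) - J (M F))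
    + (h ^ 4 / 24) •
      (-(M (M (M F))) + M (M (J g)) - M (H g g) - M (J (M (M x) - M F + J g))
        + J (M (M F)) - J (J (M F)) - J (M (J g)) + (3 : ℝ) • H (-(M F)) g)

namespace SVERK4

/-- The second internal stage (the first one is `Y₁ = x`). -/
noncomputable def stage2 (m : SVERK4) (M : X →L[ℝ] X) (f : X → X) (h : ℝ) (x : X) : X :=
  expNeg M (m.c2 * h) x + h • (m.a21 • f x)

/-- The third internal stage. -/
noncomputable def stage3 (m : SVERK4) (M : X →L[ℝ] X) (f : X → X) (h : ℝ) (x : X) : X :=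
  expNeg M (m.c3 * h) x + h • (m.a31 • f x + m.a32 • f (m.stage2 M f h x))

/-- The fourth internal stage. -/
noncomputable def stage4 (m : SVERK4) (M : X →L[ℝ] X) (f : X → X) (h : ℝ) (x : X) : X :=
  expNeg M (m.c4 * h) x
    + h • (m.a41 • f x + m.a42 • f (m.stage2 M f h x) + m.a43 • f (m.stage3 M f h x))

/-- One step of size `h` from `x`. -/
noncomputable def step (m : SVERK4) (M : X →L[ℝ] X) (f : X → X) (h : ℝ) (x : X) : X :=
  expNeg M h x
    + h • (m.b1 • f x + m.b2 • f (m.stage2 M f h x) + m.b3 • f (m.stage3 M f h x)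
      + m.b4 • f (m.stage4 M f h x))
    + sverkW4 M f h x

/-- The numerical solution `y_n`: `n` steps of size `h` from the initial value `y₀`. -/
noncomputable def numSol (m : SVERK4) (M : X →L[ℝ] X) (f : X → X) (h : ℝ) (y₀ : X) : ℕ → X
  | 0 => y₀
  | n + 1 => m.step M f h (numSol m M f h y₀ n)

end SVERK4

/-- `y` solves `y'(t) + M y(t) = f(y(t))` on `[t₀, tₑ]` (one-sided derivatives at the ends). -/
def IsSolutionOn (M : X →L[ℝ] X) (f : X → X) (y : ℝ → X) (t₀ tₑ : ℝ) : Prop :=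
  ∀ t ∈ Set.Icc t₀ tₑ, HasDerivWithinAt y (-(M (y t)) + f (y t)) (Set.Icc t₀ tₑ) t

/-- `f` is Lipschitz with constant `L` in the strip of radius `ρ` along `y` on `[t₀, tₑ]`. -/
def LipschitzInStrip (f : X → X) (y : ℝ → X) (t₀ tₑ ρ L : ℝ) : Prop :=
  ∀ t ∈ Set.Icc t₀ tₑ, ∀ v ∈ Metric.ball (y t) ρ, ∀ w ∈ Metric.ball (y t) ρ,
    ‖f v - f w‖ ≤ L * ‖v - w‖

/-- `f` is of class `C⁵` in the open strip of radius `ρ` along `y` on `[t₀, tₑ]`, and its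
derivatives of the orders `0, …, 5` are bounded by `B` there. -/
def SmoothInStrip (f : X → X) (y : ℝ → X) (t₀ tₑ ρ B : ℝ) : Prop :=
  ContDiffOn ℝ 5 f (Metric.thickening ρ (y '' Set.Icc t₀ tₑ)) ∧
    ∀ p ≤ 5, ∀ x ∈ Metric.thickening ρ (y '' Set.Icc t₀ tₑ), ‖iteratedFDeriv ℝ p f x‖ ≤ B

end Scheme

/-!
The proof is the classical one for one-step methods: consistency of order five in a single step,
stability of a single step, and accumulation of the local errors. Since `M` is bounded, no smoothing
property of the semigroup is needed.

*Consistency.* Along a curve `x + h d₁ + h² d₂ + h³ d₃` the values of `f` are expanded by Taylor's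
formula (`StepProblem.f_expansion_three`). Applied to the exact solution, together with integration
of the differential equation, which raises the order by one each time
(`StepProblem.isO_sub_of_isO_defect`), this gives the Taylor polynomial of the solution up to `h⁴`
(`StepProblem.z_expansion_four`). Applied to the stages it gives the expansions of `f (Y_i)`, all of
the same shape. Their weighted sum is determined by the eight order conditions
(`StepProblem.sum_stage_values`), and what it misses from the Taylor polynomial of the solution is
the correction term (`StepProblem.expansion_add_sverkW4`), by the symmetry of the second derivative.

*Stability.* One step differs from the identity by a map with Lipschitz constant of order `h` near
the solution (`StepProblem.step_sub_step`). A discrete Gronwall argument then yields the error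
bound; for small `h` the bound itself keeps the numerical solution in the strip
(`SVERK4.global_error`).

*Uniformity.* The constants must not depend on the Banach space or on the problem. All data of one
step are therefore collected in the type `StepProblem`, and order bounds are taken for families
indexed by this whole type, along the filter of step sizes tending to zero. A single such bound
(`UniformBigO`) is uniform in everything else.

For a globally smooth nonlinearity the compact trajectory has a strip on which all derivatives are
bounded, so the first part covers small step sizes. Larger step sizes admit only a bounded number of
steps on the interval, and the numerical solution depends continuously on `h`, so that the error is
bounded there by compactness.
-/

open Filter Topology

/-! ### Norm bounds for the exponential and for Taylor remainders -/

theorem norm_normedSpaceExp_sub_sum_le {A : Type*} [NormedRing A] [NormedAlgebra ℝ A]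
    [CompleteSpace A] (a : A) {n : ℕ} (hn : n ≠ 0) :
    ‖NormedSpace.exp a - ∑ k ∈ Finset.range n, ((k.factorial : ℝ)⁻¹) • a ^ k‖
      ≤ ‖a‖ ^ n * Real.exp ‖a‖ := by
  have hs := NormedSpace.exp_series_hasSum_exp' (𝕂 := ℝ) a
  have hr := NormedSpace.exp_series_hasSum_exp' (𝕂 := ℝ) (‖a‖ : ℝ)
  rw [← Real.exp_eq_exp_ℝ] at hr
  have h1 := (hasSum_nat_add_iff' n).2 hs
  have h2 := (hasSum_nat_add_iff' n).2 hr
  have h3 : ‖NormedSpace.exp a - ∑ k ∈ Finset.range n, ((k.factorial : ℝ)⁻¹) • a ^ k‖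
      ≤ Real.exp ‖a‖ - ∑ k ∈ Finset.range n, ((k.factorial : ℝ)⁻¹) • ‖a‖ ^ k := by
    refine h1.norm_le_of_bounded h2 fun k => ?_
    rw [norm_smul, Real.norm_of_nonneg (by positivity), smul_eq_mul]
    exact mul_le_mul_of_nonneg_left (norm_pow_le' a (by omega)) (by positivity)
  refine h3.trans ?_
  have h4 := Complex.norm_exp_sub_sum_le_norm_mul_exp ((‖a‖ : ℝ) : ℂ) n
  have h5 : Complex.exp ((‖a‖ : ℝ) : ℂ)
      - ∑ m ∈ Finset.range n, ((‖a‖ : ℝ) : ℂ) ^ m / (m.factorial : ℂ)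
      = ((Real.exp ‖a‖ - ∑ k ∈ Finset.range n, ((k.factorial : ℝ)⁻¹) • ‖a‖ ^ k : ℝ) : ℂ) := by
    push_cast
    simp [div_eq_inv_mul]
  rw [h5, Complex.norm_real, Complex.norm_real] at h4
  refine (Real.le_norm_self _).trans (h4.trans ?_)
  simp

section Taylor

variable {E F : Type*} [NormedAddCommGroup E] [NormedSpace ℝ E]
  [NormedAddCommGroup F] [NormedSpace ℝ F]

/-- Taylor's formula of order four on `[0, 1]`, with the derivatives given one by one. The constant
is not optimal. -/
theorem norm_taylor_four_le {p q r w w' : ℝ → F} {C : ℝ}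
    (hp : ∀ s ∈ Set.Icc (0 : ℝ) 1, HasDerivWithinAt p (q s) (Set.Icc 0 1) s)
    (hq : ∀ s ∈ Set.Icc (0 : ℝ) 1, HasDerivWithinAt q (r s) (Set.Icc 0 1) s)
    (hr : ∀ s ∈ Set.Icc (0 : ℝ) 1, HasDerivWithinAt r (w s) (Set.Icc 0 1) s)
    (hw : ∀ s ∈ Set.Icc (0 : ℝ) 1, HasDerivWithinAt w (w' s) (Set.Icc 0 1) s)
    (hC : ∀ s ∈ Set.Icc (0 : ℝ) 1, ‖w' s‖ ≤ C) :
    ‖p 1 - (p 0 + q 0 + (1 / 2 : ℝ) • r 0 + (1 / 6 : ℝ) • w 0)‖ ≤ C := by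
  have hC0 : 0 ≤ C := (norm_nonneg _).trans (hC 0 (by simp))
  have step : ∀ {u u' : ℝ → F},
      (∀ s ∈ Set.Icc (0 : ℝ) 1, HasDerivWithinAt u (u' s) (Set.Icc 0 1) s) → u 0 = 0 →
      (∀ s ∈ Set.Icc (0 : ℝ) 1, ‖u' s‖ ≤ C) → ∀ s ∈ Set.Icc (0 : ℝ) 1, ‖u s‖ ≤ C := by
    intro u u' hu h0 hb s hs
    have := norm_image_sub_le_of_norm_deriv_le_segment' hu
      (fun s hs => hb s (Set.Ico_subset_Icc_self hs)) s hs
    rw [h0, sub_zero, sub_zero] at this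
    exact this.trans (mul_le_of_le_one_right hC0 hs.2)
  have d1 : ∀ (c : F) (s : ℝ), HasDerivWithinAt (fun s : ℝ => s • c) c (Set.Icc 0 1) s :=
    fun c s => by simpa using ((hasDerivAt_id s).smul_const c).hasDerivWithinAt
  have d2 : ∀ (c : F) (s : ℝ),
      HasDerivWithinAt (fun s : ℝ => (s ^ 2 / 2) • c) (s • c) (Set.Icc 0 1) s := fun c s => by
    simpa using (((hasDerivAt_pow 2 s).div_const 2).smul_const c).hasDerivWithinAt
  have d3 : ∀ (c : F) (s : ℝ),
      HasDerivWithinAt (fun s : ℝ => (s ^ 3 / 6) • c) ((s ^ 2 / 2) • c) (Set.Icc 0 1) s :=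
    fun c s => by
    convert (((hasDerivAt_pow 3 s).div_const 6).smul_const c).hasDerivWithinAt using 2
    push_cast; ring
  have e1 := step (u := fun s => w s - w 0) (fun s hs => (hw s hs).sub_const _) (by simp) hC
  have e2 := step (u := fun s => r s - r 0 - s • w 0)
    (fun s hs => ((hr s hs).sub_const _).sub (d1 _ s)) (by simp) e1
  have e3 := step (u := fun s => q s - q 0 - s • r 0 - (s ^ 2 / 2) • w 0)
    (fun s hs => (((hq s hs).sub_const _).sub (d1 _ s)).sub (d2 _ s)) (by simp) e2
  have e4 := step (u := fun s => p s - p 0 - s • q 0 - (s ^ 2 / 2) • r 0 - (s ^ 3 / 6) • w 0)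
    (fun s hs => ((((hp s hs).sub_const _).sub (d1 _ s)).sub (d2 _ s)).sub (d3 _ s)) (by simp) e3
    1 (by simp)
  convert e4 using 2
  module

-- Needed for the norm on the space of continuous trilinear maps.
set_option maxSynthPendingDepth 3 in
/-- A function of class `C⁵` on a ball has a fourth order Taylor expansion at the centre whose
remainder is controlled by the bound on the fourth derivative. -/
theorem ContDiffOn.norm_sub_taylor_le {f : E → F} {x : E} {ρ B : ℝ}
    (hf : ContDiffOn ℝ 5 f (Metric.ball x ρ))
    (hB : ∀ y ∈ Metric.ball x ρ, ‖iteratedFDeriv ℝ 4 f y‖ ≤ B) {d : E} (hd : ‖d‖ < ρ) :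
    ‖f (x + d) - (f x + fderiv ℝ f x d + (1 / 2 : ℝ) • fderiv ℝ (fderiv ℝ f) x d d
        + (1 / 6 : ℝ) • fderiv ℝ (fderiv ℝ (fderiv ℝ f)) x d d d)‖ ≤ B * ‖d‖ ^ 4 := by
  have ho : IsOpen (Metric.ball x ρ) := Metric.isOpen_ball
  have c1 : ContDiffOn ℝ 4 (fderiv ℝ f) (Metric.ball x ρ) := hf.fderiv_of_isOpen ho (by norm_num)
  have c2 : ContDiffOn ℝ 3 (fderiv ℝ (fderiv ℝ f)) (Metric.ball x ρ) :=
    c1.fderiv_of_isOpen ho (by norm_num)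
  have c3 : ContDiffOn ℝ 2 (fderiv ℝ (fderiv ℝ (fderiv ℝ f))) (Metric.ball x ρ) :=
    c2.fderiv_of_isOpen ho (by norm_num)
  have hmem : ∀ s ∈ Set.Icc (0 : ℝ) 1, x + s • d ∈ Metric.ball x ρ := by
    intro s hs
    rw [mem_ball_iff_norm, add_sub_cancel_left, norm_smul, Real.norm_of_nonneg hs.1]
    exact (mul_le_of_le_one_left (norm_nonneg _) hs.2).trans_lt hd
  have hline : ∀ s : ℝ, HasDerivAt (fun s : ℝ => x + s • d) d s := fun s => by
    simpa using ((hasDerivAt_id s).smul_const d).const_add x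
  have hd0 : ∀ s ∈ Set.Icc (0 : ℝ) 1,
      HasDerivAt (fun s : ℝ => f (x + s • d)) (fderiv ℝ f (x + s • d) d) s := fun s hs =>
    ((hf.contDiffAt (ho.mem_nhds (hmem s hs))).differentiableAt
      (by norm_num)).hasFDerivAt.comp_hasDerivAt s (hline s)
  have hd1 : ∀ s ∈ Set.Icc (0 : ℝ) 1, HasDerivAt (fun s : ℝ => fderiv ℝ f (x + s • d))
      (fderiv ℝ (fderiv ℝ f) (x + s • d) d) s := fun s hs =>
    ((c1.contDiffAt (ho.mem_nhds (hmem s hs))).differentiableAt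
      (by norm_num)).hasFDerivAt.comp_hasDerivAt s (hline s)
  have hd2 : ∀ s ∈ Set.Icc (0 : ℝ) 1, HasDerivAt (fun s : ℝ => fderiv ℝ (fderiv ℝ f) (x + s • d))
      (fderiv ℝ (fderiv ℝ (fderiv ℝ f)) (x + s • d) d) s := fun s hs =>
    ((c2.contDiffAt (ho.mem_nhds (hmem s hs))).differentiableAt
      (by norm_num)).hasFDerivAt.comp_hasDerivAt s (hline s)
  have hd3 : ∀ s ∈ Set.Icc (0 : ℝ) 1,
      HasDerivAt (fun s : ℝ => fderiv ℝ (fderiv ℝ (fderiv ℝ f)) (x + s • d))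
      (fderiv ℝ (fderiv ℝ (fderiv ℝ (fderiv ℝ f))) (x + s • d) d) s := fun s hs =>
    ((c3.contDiffAt (ho.mem_nhds (hmem s hs))).differentiableAt
      (by norm_num)).hasFDerivAt.comp_hasDerivAt s (hline s)
  have := norm_taylor_four_le (C := B * ‖d‖ ^ 4)
    (p := fun s => f (x + s • d)) (q := fun s => fderiv ℝ f (x + s • d) d)
    (r := fun s => fderiv ℝ (fderiv ℝ f) (x + s • d) d d)
    (w := fun s => fderiv ℝ (fderiv ℝ (fderiv ℝ f)) (x + s • d) d d d)
    (w' := fun s => fderiv ℝ (fderiv ℝ (fderiv ℝ (fderiv ℝ f))) (x + s • d) d d d d)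
    (fun s hs => (hd0 s hs).hasDerivWithinAt)
    (fun s hs => ((ContinuousLinearMap.apply ℝ F d).hasFDerivAt.comp_hasDerivAt s
      (hd1 s hs)).hasDerivWithinAt)
    (fun s hs => ((ContinuousLinearMap.apply ℝ F d).hasFDerivAt.comp_hasDerivAt s
      ((ContinuousLinearMap.apply ℝ (E →L[ℝ] F) d).hasFDerivAt.comp_hasDerivAt s
        (hd2 s hs))).hasDerivWithinAt)
    (fun s hs => ((ContinuousLinearMap.apply ℝ F d).hasFDerivAt.comp_hasDerivAt s
      ((ContinuousLinearMap.apply ℝ (E →L[ℝ] F) d).hasFDerivAt.comp_hasDerivAt s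
        ((ContinuousLinearMap.apply ℝ (E →L[ℝ] E →L[ℝ] F) d).hasFDerivAt.comp_hasDerivAt s
          (hd3 s hs)))).hasDerivWithinAt)
    (fun s hs => by
      have h4 : ‖fderiv ℝ (fderiv ℝ (fderiv ℝ (fderiv ℝ f))) (x + s • d)‖ ≤ B := by
        rw [← norm_iteratedFDeriv_one, norm_iteratedFDeriv_fderiv, norm_iteratedFDeriv_fderiv,
          norm_iteratedFDeriv_fderiv]
        exact hB _ (hmem s hs)
      refine (ContinuousLinearMap.le_of_opNorm_le _ (ContinuousLinearMap.le_of_opNorm_le _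
        (ContinuousLinearMap.le_of_opNorm_le _ (ContinuousLinearMap.le_of_opNorm_le _ h4 d)
          d) d) d).trans (le_of_eq (by ring)))
  simpa using this

end Taylor

/-! ### Uniform order bounds for families of vectors in varying spaces -/

section UniformBigO

variable {ι : Type*} {E F : ι → Type*} [∀ i, NormedAddCommGroup (E i)]
  [∀ i, NormedAddCommGroup (F i)] {l : Filter ι} {g g' : ι → ℝ}

/-- `UniformBigO l g u`: along the filter `l`, the vectors `u i` are bounded by a constant multiple
of `g i`. Each `u i` may live in a space of its own, so that a constant obtained in this way is
uniform over all the spaces involved. -/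
def UniformBigO (l : Filter ι) (g : ι → ℝ) (u : ∀ i, E i) : Prop :=
  (fun i => ‖u i‖) =O[l] g

namespace UniformBigO

theorem of_le {u : ∀ i, E i} (C : ℝ) (hu : ∀ i, ‖u i‖ ≤ C * ‖g i‖) : UniformBigO l g u :=
  Asymptotics.IsBigO.of_bound C (Eventually.of_forall fun i => by simpa using hu i)

theorem trans {u : ∀ i, E i} (hu : UniformBigO l g u) (h : g =O[l] g') : UniformBigO l g' u :=
  Asymptotics.IsBigO.trans hu h

theorem of_norm_le {u : ∀ i, E i} {v : ∀ i, F i} (hv : UniformBigO l g v)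
    (h : ∀ᶠ i in l, ‖u i‖ ≤ ‖v i‖) : UniformBigO l g u :=
  Asymptotics.IsBigO.trans (Asymptotics.IsBigO.of_bound 1 (by simpa using h)) hv

theorem congr {u v : ∀ i, E i} (hu : UniformBigO l g u) (h : ∀ i, u i = v i) :
    UniformBigO l g v :=
  hu.of_norm_le (Eventually.of_forall fun i => by rw [h])

theorem add {u v : ∀ i, E i} (hu : UniformBigO l g u) (hv : UniformBigO l g v) :
    UniformBigO l g fun i => u i + v i := by
  have h : (fun i => ‖u i‖ + ‖v i‖) =O[l] g := Asymptotics.IsBigO.add hu hv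
  refine Asymptotics.IsBigO.trans (Asymptotics.IsBigO.of_bound 1 ?_) h
  refine Eventually.of_forall fun i => ?_
  rw [norm_norm, one_mul, Real.norm_of_nonneg (by positivity)]
  exact norm_add_le _ _

theorem neg {u : ∀ i, E i} (hu : UniformBigO l g u) : UniformBigO l g fun i => -u i :=
  hu.of_norm_le (by simp)

theorem sub {u v : ∀ i, E i} (hu : UniformBigO l g u) (hv : UniformBigO l g v) :
    UniformBigO l g fun i => u i - v i :=
  (hu.add hv.neg).congr fun _ => (sub_eq_add_neg _ _).symm

theorem smul [∀ i, NormedSpace ℝ (E i)] {c : ι → ℝ} {u : ∀ i, E i} (hc : c =O[l] g)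
    (hu : UniformBigO l g' u) : UniformBigO l (fun i => g i * g' i) fun i => c i • u i := by
  have h := Asymptotics.IsBigO.mul hc hu
  refine Asymptotics.IsBigO.trans (Asymptotics.IsBigO.of_bound 1 ?_) h
  exact Eventually.of_forall fun _ => by simp [norm_smul]

theorem const_smul [∀ i, NormedSpace ℝ (E i)] (c : ℝ) {u : ∀ i, E i} (hu : UniformBigO l g u) :
    UniformBigO l g fun i => c • u i := by
  have h := UniformBigO.smul (g := fun _ => (1 : ℝ))
    (Asymptotics.isBigO_const_const c one_ne_zero l) hu
  simpa using h

theorem clm_apply [∀ i, NormedSpace ℝ (E i)] [∀ i, NormedSpace ℝ (F i)]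
    {A : ∀ i, E i →L[ℝ] F i} {u : ∀ i, E i} (hA : UniformBigO l g A)
    (hu : UniformBigO l g' u) : UniformBigO l (fun i => g i * g' i) fun i => A i (u i) := by
  have h := Asymptotics.IsBigO.mul hA hu
  refine Asymptotics.IsBigO.trans (Asymptotics.IsBigO.of_bound 1 ?_) h
  exact Eventually.of_forall fun i => by
    simpa using (A i).le_opNorm (u i)

/-- Applying uniformly bounded operators does not change the order. -/
theorem clm_apply_of_bounded [∀ i, NormedSpace ℝ (E i)] [∀ i, NormedSpace ℝ (F i)]
    {A : ∀ i, E i →L[ℝ] F i} {u : ∀ i, E i} (hA : UniformBigO l (fun _ => 1) A)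
    (hu : UniformBigO l g u) : UniformBigO l g fun i => A i (u i) := by
  simpa using hA.clm_apply hu

/-- Operators of a given order, applied to uniformly bounded vectors. -/
theorem clm_apply_bounded [∀ i, NormedSpace ℝ (E i)] [∀ i, NormedSpace ℝ (F i)]
    {A : ∀ i, E i →L[ℝ] F i} {u : ∀ i, E i} (hA : UniformBigO l g A)
    (hu : UniformBigO l (fun _ => 1) u) : UniformBigO l g fun i => A i (u i) := by
  simpa using hA.clm_apply hu

/-- A family of order `g` is eventually `g` times a bounded family. -/
theorem exists_eq_smul [∀ i, NormedSpace ℝ (E i)] {u : ∀ i, E i} (hu : UniformBigO l g u) :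
    ∃ d : ∀ i, E i, UniformBigO l (fun _ => 1) d ∧ ∀ᶠ i in l, u i = g i • d i := by
  obtain ⟨C, hC⟩ := Asymptotics.IsBigO.bound hu
  refine ⟨fun i => (g i)⁻¹ • u i, Asymptotics.IsBigO.of_bound |C| ?_, ?_⟩
  · filter_upwards [hC] with i hi
    rw [norm_norm] at hi
    rw [norm_norm, norm_smul, norm_one, mul_one, norm_inv]
    by_cases h0 : g i = 0
    · simp [h0]
    · rw [inv_mul_le_iff₀ (norm_pos_iff.2 h0), mul_comm]
      exact hi.trans (mul_le_mul_of_nonneg_right (le_abs_self C) (norm_nonneg _))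
  · filter_upwards [hC] with i hi
    rw [norm_norm] at hi
    by_cases h0 : g i = 0
    · have : ‖u i‖ ≤ 0 := by simpa [h0] using hi
      simpa [h0] using this
    · rw [smul_inv_smul₀ h0]

/-- A family of order `g → 0` is eventually smaller than any positive number. -/
theorem eventually_norm_lt {u : ∀ i, E i} (hu : UniformBigO l g u) (hg : Tendsto g l (𝓝 0))
    {ε : ℝ} (hε : 0 < ε) : ∀ᶠ i in l, ‖u i‖ < ε :=
  (Asymptotics.IsBigO.trans_tendsto hu hg).eventually_lt_const hε

end UniformBigO

/-- Two bounded families whose difference is of order `g`. This relation is preserved by sums,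
bounded scalars and the application of operators, which makes Lipschitz estimates for expressions
built from these operations automatic. -/
structure UniformlyClose (l : Filter ι) (g : ι → ℝ) (u v : ∀ i, E i) : Prop where
  left : UniformBigO l (fun _ => 1) u
  right : UniformBigO l (fun _ => 1) v
  diff : UniformBigO l g fun i => u i - v i

namespace UniformlyClose

theorem add {u v u' v' : ∀ i, E i} (h : UniformlyClose l g u v) (h' : UniformlyClose l g u' v') :
    UniformlyClose l g (fun i => u i + u' i) (fun i => v i + v' i) :=
  ⟨h.left.add h'.left, h.right.add h'.right,
    (h.diff.add h'.diff).congr fun _ => (add_sub_add_comm _ _ _ _).symm⟩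

theorem neg {u v : ∀ i, E i} (h : UniformlyClose l g u v) :
    UniformlyClose l g (fun i => -u i) (fun i => -v i) :=
  ⟨h.left.neg, h.right.neg, h.diff.neg.congr fun _ => by abel⟩

theorem sub {u v u' v' : ∀ i, E i} (h : UniformlyClose l g u v) (h' : UniformlyClose l g u' v') :
    UniformlyClose l g (fun i => u i - u' i) (fun i => v i - v' i) :=
  ⟨h.left.sub h'.left, h.right.sub h'.right,
    (h.diff.sub h'.diff).congr fun _ => by abel⟩

theorem smul [∀ i, NormedSpace ℝ (E i)] {c : ι → ℝ} (hc : c =O[l] fun _ => (1 : ℝ))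
    {u v : ∀ i, E i} (h : UniformlyClose l g u v) :
    UniformlyClose l g (fun i => c i • u i) (fun i => c i • v i) :=
  ⟨by simpa using UniformBigO.smul hc h.left, by simpa using UniformBigO.smul hc h.right, by
    have := UniformBigO.smul hc h.diff
    simp only [one_mul] at this
    exact this.congr fun _ => smul_sub _ _ _⟩

theorem clm_apply [∀ i, NormedSpace ℝ (E i)] [∀ i, NormedSpace ℝ (F i)]
    {A B : ∀ i, E i →L[ℝ] F i} {u v : ∀ i, E i} (hA : UniformlyClose l g A B)
    (h : UniformlyClose l g u v) :
    UniformlyClose l g (fun i => A i (u i)) (fun i => B i (v i)) :=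
  ⟨hA.left.clm_apply_of_bounded h.left, hA.right.clm_apply_of_bounded h.right,
    ((hA.diff.clm_apply_bounded h.left).add (hA.right.clm_apply_of_bounded h.diff)).congr
      fun i => by simp⟩

theorem const {u : ∀ i, E i} (h : UniformBigO l (fun _ => 1) u) : UniformlyClose l g u u :=
  ⟨h, h, UniformBigO.of_le 0 (by simp)⟩

end UniformlyClose

end UniformBigO

/-! ### Uniform bounds for one step -/

/-- The data of one step of the scheme: a solution `z` of the differential equation on `[0, h]`, a
point `v` near `z 0` from which the scheme starts, and bounds on the operator, on the solution and
on the derivatives of the nonlinearity in a ball around `z 0`. The Banach space is part of the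
data, so that estimates over all members of this type are uniform in it. -/
structure StepProblem (K R B ρ : ℝ) where
  X : Type u
  [normed : NormedAddCommGroup X]
  [space : NormedSpace ℝ X]
  [complete : CompleteSpace X]
  M : X →L[ℝ] X
  f : X → X
  z : ℝ → X
  v : X
  h : ℝ
  h_nonneg : 0 ≤ h
  norm_M_le : ‖M‖ ≤ K
  isSolutionOn : IsSolutionOn M f z 0 h
  norm_z_le : ∀ s ∈ Set.Icc 0 h, ‖z s‖ ≤ R
  norm_f_z_le : ∀ s ∈ Set.Icc 0 h, ‖f (z s)‖ ≤ B
  contDiffOn : ContDiffOn ℝ 5 f (Metric.ball (z 0) ρ)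
  norm_iteratedFDeriv_le : ∀ p ≤ 5, ∀ x ∈ Metric.ball (z 0) ρ, ‖iteratedFDeriv ℝ p f x‖ ≤ B
  norm_v_sub_le : ‖v - z 0‖ ≤ ρ / 2

attribute [instance] StepProblem.normed StepProblem.space StepProblem.complete

namespace StepProblem

variable {K R B ρ : ℝ}

/-- The limit of small step sizes, uniformly in all other data. -/
def small (K R B ρ : ℝ) : Filter (StepProblem.{u} K R B ρ) := comap StepProblem.h (𝓝 0)

/-- The family `u` is bounded, uniformly as the step size tends to zero. -/
abbrev Bounded {E : StepProblem.{u} K R B ρ → Type*} [∀ i, NormedAddCommGroup (E i)]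
    (u : ∀ i, E i) : Prop :=
  UniformBigO (small K R B ρ) (fun _ => 1) u

/-- The family `u` is of order `h ^ k`, uniformly as the step size `h` tends to zero. -/
abbrev IsO (k : ℕ) {E : StepProblem.{u} K R B ρ → Type*} [∀ i, NormedAddCommGroup (E i)]
    (u : ∀ i, E i) : Prop :=
  UniformBigO (small K R B ρ) (fun i => i.h ^ k) u

/-- The exact value at the beginning of the step. -/
abbrev x (i : StepProblem.{u} K R B ρ) : i.X := i.z 0

/-- The nonlinearity at `x`. -/
abbrev F (i : StepProblem.{u} K R B ρ) : i.X := i.f i.x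

/-- The first derivative of the nonlinearity at `x`. -/
noncomputable abbrev J (i : StepProblem.{u} K R B ρ) : i.X →L[ℝ] i.X := fderiv ℝ i.f i.x

/-- The second derivative of the nonlinearity at `x`. -/
noncomputable abbrev H (i : StepProblem.{u} K R B ρ) : i.X →L[ℝ] i.X →L[ℝ] i.X :=
  fderiv ℝ (fderiv ℝ i.f) i.x

/-- The third derivative of the nonlinearity at `x`. -/
noncomputable abbrev D (i : StepProblem.{u} K R B ρ) : i.X →L[ℝ] i.X →L[ℝ] i.X →L[ℝ] i.X :=
  fderiv ℝ (fderiv ℝ (fderiv ℝ i.f)) i.x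

theorem tendsto_h : Tendsto StepProblem.h (small.{u} K R B ρ) (𝓝 0) := tendsto_comap

theorem eventually_h_lt {ε : ℝ} (hε : 0 < ε) : ∀ᶠ i in small.{u} K R B ρ, i.h < ε :=
  tendsto_h.eventually_lt_const hε

section Order

variable {E : StepProblem.{u} K R B ρ → Type*} [∀ i, NormedAddCommGroup (E i)]
  {u : ∀ i, E i}

theorem IsO.mono {k m : ℕ} (hu : IsO k u) (hm : m ≤ k) : IsO m u := by
  refine UniformBigO.trans hu (Asymptotics.IsBigO.of_bound 1 ?_)
  filter_upwards [eventually_h_lt one_pos] with i hi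
  rw [norm_pow, norm_pow, one_mul, Real.norm_of_nonneg i.h_nonneg]
  exact pow_le_pow_of_le_one i.h_nonneg hi.le hm

theorem IsO.pow_smul [∀ i, NormedSpace ℝ (E i)] {k : ℕ} (m : ℕ) (hu : IsO k u) :
    IsO (m + k) fun i => i.h ^ m • u i := by
  have := UniformBigO.smul (Asymptotics.isBigO_refl (fun i => i.h ^ m) (small K R B ρ)) hu
  simpa only [← pow_add] using this

theorem IsO.h_smul [∀ i, NormedSpace ℝ (E i)] {k : ℕ} (hu : IsO k u) :
    IsO (k + 1) fun i => i.h • u i := by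
  simpa [add_comm] using hu.pow_smul 1

theorem Bounded.pow_smul [∀ i, NormedSpace ℝ (E i)] (m : ℕ) (hu : Bounded u) :
    IsO m fun i => i.h ^ m • u i := by
  have := UniformBigO.smul (Asymptotics.isBigO_refl (fun i => i.h ^ m) (small K R B ρ)) hu
  simpa only [mul_one] using this

theorem Bounded.h_smul [∀ i, NormedSpace ℝ (E i)] (hu : Bounded u) :
    IsO 1 fun i => i.h • u i := by
  simpa using hu.pow_smul 1

theorem IsO.bounded {k : ℕ} (hu : IsO k u) : Bounded u := by
  refine UniformBigO.trans (hu.mono (Nat.zero_le k)) ?_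
  simpa only [pow_zero] using Asymptotics.isBigO_refl _ _

theorem Bounded.of_norm_le (C : ℝ) (h : ∀ i, ‖u i‖ ≤ C) : Bounded u :=
  UniformBigO.of_le C (by simpa using h)

theorem isO_of_eventually_eq_zero (k : ℕ) (h : ∀ᶠ i in small K R B ρ, u i = 0) : IsO k u :=
  Asymptotics.IsBigO.of_bound 0 (by filter_upwards [h] with i hi; simp [hi])

end Order

theorem zero_mem_Icc (i : StepProblem.{u} K R B ρ) : (0 : ℝ) ∈ Set.Icc 0 i.h := ⟨le_rfl, i.h_nonneg⟩

theorem h_mem_Icc (i : StepProblem.{u} K R B ρ) : i.h ∈ Set.Icc 0 i.h := ⟨i.h_nonneg, le_rfl⟩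

theorem bounded_M : Bounded fun i : StepProblem.{u} K R B ρ => i.M :=
  Bounded.of_norm_le K fun i => i.norm_M_le

theorem bounded_x : Bounded fun i : StepProblem.{u} K R B ρ => i.x :=
  Bounded.of_norm_le R fun i => i.norm_z_le 0 i.zero_mem_Icc

theorem bounded_F : Bounded fun i : StepProblem.{u} K R B ρ => i.F :=
  Bounded.of_norm_le B fun i => i.norm_f_z_le 0 i.zero_mem_Icc

theorem norm_f_le (i : StepProblem.{u} K R B ρ) {w : i.X} (hw : w ∈ Metric.ball i.x ρ) :
    ‖i.f w‖ ≤ B := by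
  simpa using i.norm_iteratedFDeriv_le 0 (by norm_num) w hw

theorem norm_fderiv_le (i : StepProblem.{u} K R B ρ) {w : i.X} (hw : w ∈ Metric.ball i.x ρ) :
    ‖fderiv ℝ i.f w‖ ≤ B := by
  simpa [norm_iteratedFDeriv_one] using i.norm_iteratedFDeriv_le 1 (by norm_num) w hw

theorem norm_fderiv_two_le (i : StepProblem.{u} K R B ρ) {w : i.X}
    (hw : w ∈ Metric.ball i.x ρ) : ‖fderiv ℝ (fderiv ℝ i.f) w‖ ≤ B := by
  rw [← norm_iteratedFDeriv_one, norm_iteratedFDeriv_fderiv]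
  exact i.norm_iteratedFDeriv_le 2 (by norm_num) w hw

set_option maxSynthPendingDepth 3 in
theorem norm_fderiv_three_le (i : StepProblem.{u} K R B ρ) {w : i.X}
    (hw : w ∈ Metric.ball i.x ρ) : ‖fderiv ℝ (fderiv ℝ (fderiv ℝ i.f)) w‖ ≤ B := by
  rw [← norm_iteratedFDeriv_one, norm_iteratedFDeriv_fderiv, norm_iteratedFDeriv_fderiv]
  exact i.norm_iteratedFDeriv_le 3 (by norm_num) w hw

theorem bounded_J (hρ : 0 < ρ) : Bounded fun i : StepProblem.{u} K R B ρ => i.J :=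
  Bounded.of_norm_le B fun i => i.norm_fderiv_le (Metric.mem_ball_self hρ)

theorem bounded_H (hρ : 0 < ρ) : Bounded fun i : StepProblem.{u} K R B ρ => i.H :=
  Bounded.of_norm_le B fun i => i.norm_fderiv_two_le (Metric.mem_ball_self hρ)

set_option maxSynthPendingDepth 3 in
theorem bounded_D (hρ : 0 < ρ) : Bounded fun i : StepProblem.{u} K R B ρ => i.D :=
  Bounded.of_norm_le B fun i => i.norm_fderiv_three_le (Metric.mem_ball_self hρ)

theorem H_symm (hρ : 0 < ρ) (i : StepProblem.{u} K R B ρ) (a b : i.X) : i.H a b = i.H b a :=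
  ((i.contDiffOn.contDiffAt (Metric.ball_mem_nhds _ hρ)).isSymmSndFDerivAt (by norm_num)).eq a b

/-! ### Expansion of the nonlinearity along an expansion in the step size -/

set_option maxSynthPendingDepth 3 in
/-- The Taylor polynomial of degree three at `h d₁ + h² d₂ + h³ d₃ + h⁴ r`, sorted by powers of
`h`. -/
theorem taylor_polynomial_expansion {X : Type*} [NormedAddCommGroup X] [NormedSpace ℝ X]
    (J : X →L[ℝ] X) (H : X →L[ℝ] X →L[ℝ] X) (hH : ∀ a b, H a b = H b a)
    (D : X →L[ℝ] X →L[ℝ] X →L[ℝ] X) (h : ℝ) {d d₁ d₂ d₃ r e e₁ e₂ : X} (he₂ : e₂ = d₃ + h • r)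
    (he₁ : e₁ = d₂ + h • e₂) (he : e = d₁ + h • e₁) (hd : d = h • e) :
    J d + (1 / 2 : ℝ) • H d d + (1 / 6 : ℝ) • D d d d
      = (h • J d₁ + h ^ 2 • (J d₂ + (1 / 2 : ℝ) • H d₁ d₁)
          + h ^ 3 • (J d₃ + H d₁ d₂ + (1 / 6 : ℝ) • D d₁ d₁ d₁))
        + h ^ 4 • (J r + H d₁ e₂ + (1 / 2 : ℝ) • H e₁ e₁
          + (1 / 6 : ℝ) • (D e₁ e e + D d₁ e₁ e + D d₁ d₁ e₁)) := by
  have h1 : J d = h • J d₁ + h ^ 2 • J d₂ + h ^ 3 • J d₃ + h ^ 4 • J r := by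
    subst he₂ he₁ he hd
    simp only [map_add, map_smul]
    module
  have h2 : H d d = h ^ 2 • H d₁ d₁ + (2 * h ^ 3) • H d₁ d₂ + (2 * h ^ 4) • H d₁ e₂
      + h ^ 4 • H e₁ e₁ := by
    have h21 : H d₁ e₁ = H d₁ d₂ + h • H d₁ e₂ := by simp only [he₁, map_add, map_smul]
    rw [hd, he]
    simp only [map_add, map_smul, add_apply, smul_apply, hH e₁ d₁, h21]
    module
  have h3 : D d d d = h ^ 3 • D d₁ d₁ d₁ + h ^ 4 • (D e₁ e e + D d₁ e₁ e + D d₁ d₁ e₁) := by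
    rw [hd, he]
    simp only [map_add, map_smul, add_apply, smul_apply]
    module
  rw [h1, h2, h3]
  module

set_option maxSynthPendingDepth 3 in
/-- The expansion of `f u` to third order when `u` is given to third order. -/
theorem f_expansion_three (hρ : 0 < ρ) {u d₁ d₂ d₃ : ∀ i : StepProblem.{u} K R B ρ, i.X}
    (h₁ : Bounded d₁) (h₂ : Bounded d₂) (h₃ : Bounded d₃)
    (hu : IsO 4 fun i => u i - (i.x + i.h • d₁ i + i.h ^ 2 • d₂ i + i.h ^ 3 • d₃ i)) :
    IsO 4 fun i => i.f (u i) - (i.F + i.h • i.J (d₁ i)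
      + i.h ^ 2 • (i.J (d₂ i) + (1 / 2 : ℝ) • i.H (d₁ i) (d₁ i))
      + i.h ^ 3 • (i.J (d₃ i) + i.H (d₁ i) (d₂ i)
        + (1 / 6 : ℝ) • i.D (d₁ i) (d₁ i) (d₁ i))) := by
  obtain ⟨r, (hr : Bounded r), hur⟩ := hu.exists_eq_smul
  -- Absorbing the remainder in the coefficients makes the expansion of `u` exact.
  set e₂ : ∀ i : StepProblem.{u} K R B ρ, i.X := fun i => d₃ i + i.h • r i with he₂
  set e₁ : ∀ i : StepProblem.{u} K R B ρ, i.X := fun i => d₂ i + i.h • e₂ i with he₁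
  set e : ∀ i : StepProblem.{u} K R B ρ, i.X := fun i => d₁ i + i.h • e₁ i with he
  have b₂ : Bounded e₂ := h₃.add hr.h_smul.bounded
  have b₁ : Bounded e₁ := h₂.add b₂.h_smul.bounded
  have b : Bounded e := h₁.add b₁.h_smul.bounded
  have hd : ∀ᶠ i in small K R B ρ, u i - i.x = i.h • e i := by
    filter_upwards [hur] with i hi
    rw [sub_eq_iff_eq_add] at hi
    rw [hi]
    simp only [he, he₁, he₂]
    module
  have hd1 : IsO 1 fun i => u i - i.x :=
    b.h_smul.of_norm_le (by filter_upwards [hd] with i hi; rw [hi])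
  have hJ := bounded_J (K := K) (R := R) (B := B) hρ
  have hH := bounded_H (K := K) (R := R) (B := B) hρ
  have hD := bounded_D (K := K) (R := R) (B := B) hρ
  have htaylor : IsO 4 fun i => i.f (u i) - (i.F + i.J (u i - i.x)
      + (1 / 2 : ℝ) • i.H (u i - i.x) (u i - i.x)
      + (1 / 6 : ℝ) • i.D (u i - i.x) (u i - i.x) (u i - i.x)) := by
    have h4 : (fun i => ‖u i - i.x‖ ^ 4) =O[small K R B ρ] fun i => i.h ^ 4 := by
      simpa using Asymptotics.IsBigO.pow hd1 4
    refine Asymptotics.IsBigO.trans (Asymptotics.IsBigO.of_bound B ?_) h4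
    filter_upwards [hd1.eventually_norm_lt (by simpa using tendsto_h) hρ] with i hi
    have := i.contDiffOn.norm_sub_taylor_le (i.norm_iteratedFDeriv_le 4 (by norm_num)) hi
    rw [add_sub_cancel] at this
    rw [norm_norm, norm_pow, norm_norm]
    exact this
  have hrem : IsO 4 fun i => i.h ^ 4 • (i.J (r i) + i.H (d₁ i) (e₂ i)
      + (1 / 2 : ℝ) • i.H (e₁ i) (e₁ i) + (1 / 6 : ℝ) • (i.D (e₁ i) (e i) (e i)
        + i.D (d₁ i) (e₁ i) (e i) + i.D (d₁ i) (d₁ i) (e₁ i))) := by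
    refine Bounded.pow_smul 4 ?_
    exact (((hJ.clm_apply_of_bounded hr).add ((hH.clm_apply_of_bounded h₁).clm_apply_of_bounded
      b₂)).add (((hH.clm_apply_of_bounded b₁).clm_apply_of_bounded b₁).const_smul _)).add
      (((((hD.clm_apply_of_bounded b₁).clm_apply_of_bounded b).clm_apply_of_bounded b).add
      (((hD.clm_apply_of_bounded h₁).clm_apply_of_bounded b₁).clm_apply_of_bounded b)).add
      (((hD.clm_apply_of_bounded h₁).clm_apply_of_bounded h₁).clm_apply_of_bounded b₁)
        |>.const_smul _)
  refine (htaylor.add hrem).of_norm_le ?_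
  filter_upwards [hd] with i hi
  have := taylor_polynomial_expansion i.J i.H (i.H_symm hρ) i.D i.h (r := r i) (d₃ := d₃ i)
    (e₂ := e₂ i) (e₁ := e₁ i) (e := e i) (d₂ := d₂ i) (d₁ := d₁ i) rfl rfl rfl hi
  refine le_of_eq (congrArg norm ?_)
  linear_combination (norm := module) this

set_option maxSynthPendingDepth 3 in
theorem f_expansion_two (hρ : 0 < ρ) {u d₁ d₂ : ∀ i : StepProblem.{u} K R B ρ, i.X}
    (h₁ : Bounded d₁) (h₂ : Bounded d₂)
    (hu : IsO 3 fun i => u i - (i.x + i.h • d₁ i + i.h ^ 2 • d₂ i)) :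
    IsO 3 fun i => i.f (u i) - (i.F + i.h • i.J (d₁ i)
      + i.h ^ 2 • (i.J (d₂ i) + (1 / 2 : ℝ) • i.H (d₁ i) (d₁ i))) := by
  obtain ⟨d₃, h₃, hd⟩ := hu.exists_eq_smul
  have key := f_expansion_three hρ h₁ h₂ h₃ (u := u) (isO_of_eventually_eq_zero 4 (by
    filter_upwards [hd] with i hi
    rw [← sub_sub, hi, sub_self]))
  have hJ := bounded_J (K := K) (R := R) (B := B) hρ
  have hH := bounded_H (K := K) (R := R) (B := B) hρ
  have hD := bounded_D (K := K) (R := R) (B := B) hρ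
  refine ((key.mono (by norm_num)).add (Bounded.pow_smul 3
    (((hJ.clm_apply_of_bounded h₃).add ((hH.clm_apply_of_bounded h₁).clm_apply_of_bounded h₂)).add
      ((((hD.clm_apply_of_bounded h₁).clm_apply_of_bounded h₁).clm_apply_of_bounded
        h₁).const_smul (1 / 6))))).congr fun i => ?_
  abel

theorem f_expansion_one (hρ : 0 < ρ) {u d₁ : ∀ i : StepProblem.{u} K R B ρ, i.X} (h₁ : Bounded d₁)
    (hu : IsO 2 fun i => u i - (i.x + i.h • d₁ i)) :
    IsO 2 fun i => i.f (u i) - (i.F + i.h • i.J (d₁ i)) := by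
  obtain ⟨d₂, h₂, hd⟩ := hu.exists_eq_smul
  have key := f_expansion_two hρ h₁ h₂ (u := u) (isO_of_eventually_eq_zero 3 (by
    filter_upwards [hd] with i hi
    rw [← sub_sub, hi, sub_self]))
  have hJ := bounded_J (K := K) (R := R) (B := B) hρ
  have hH := bounded_H (K := K) (R := R) (B := B) hρ
  refine ((key.mono (by norm_num)).add (Bounded.pow_smul 2 ((hJ.clm_apply_of_bounded h₂).add
    (((hH.clm_apply_of_bounded h₁).clm_apply_of_bounded h₁).const_smul (1 / 2))))).congr
      fun i => ?_
  abel

theorem f_expansion_zero (hρ : 0 < ρ) {u : ∀ i : StepProblem.{u} K R B ρ, i.X}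
    (hu : IsO 1 fun i => u i - i.x) : IsO 1 fun i => i.f (u i) - i.F := by
  obtain ⟨d₁, (h₁ : Bounded d₁), hd⟩ := hu.exists_eq_smul
  have key := f_expansion_one hρ h₁ (u := u) (isO_of_eventually_eq_zero 2 (by
    filter_upwards [hd] with i hi
    rw [← sub_sub, hi, pow_one, sub_self]))
  refine ((key.mono (by norm_num)).add
    (Bounded.h_smul ((bounded_J hρ).clm_apply_of_bounded h₁))).congr fun i => ?_
  abel

/-! ### Expansion of the exact solution -/

/-- The same problem with a smaller step size `σ`. -/
def restrict (i : StepProblem.{u} K R B ρ) (σ : ℝ) (hσ : σ ∈ Set.Icc 0 i.h) :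
    StepProblem.{u} K R B ρ where
  X := i.X
  M := i.M
  f := i.f
  z := i.z
  v := i.v
  h := σ
  h_nonneg := hσ.1
  norm_M_le := i.norm_M_le
  isSolutionOn := fun s hs => (i.isSolutionOn s ⟨hs.1, hs.2.trans hσ.2⟩).mono
    (Set.Icc_subset_Icc_right hσ.2)
  norm_z_le := fun s hs => i.norm_z_le s ⟨hs.1, hs.2.trans hσ.2⟩
  norm_f_z_le := fun s hs => i.norm_f_z_le s ⟨hs.1, hs.2.trans hσ.2⟩
  contDiffOn := i.contDiffOn
  norm_iteratedFDeriv_le := i.norm_iteratedFDeriv_le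
  norm_v_sub_le := i.norm_v_sub_le

/-- A uniform order bound holds with explicit constants for all sufficiently small step sizes. -/
theorem exists_bound {E : StepProblem.{u} K R B ρ → Type*} [∀ i, NormedAddCommGroup (E i)]
    {u : ∀ i, E i} {g : StepProblem.{u} K R B ρ → ℝ} (hu : UniformBigO (small K R B ρ) g u) :
    ∃ C ε : ℝ, 0 ≤ C ∧ 0 < ε ∧ ∀ i, i.h < ε → ‖u i‖ ≤ C * ‖g i‖ := by
  obtain ⟨C, hC0, hC⟩ := Asymptotics.IsBigO.exists_nonneg hu
  have hC := hC.bound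
  rw [small, eventually_comap] at hC
  obtain ⟨ε, hε, h⟩ := Metric.eventually_nhds_iff.1 hC
  refine ⟨C, ε, hC0, hε, fun i hi => ?_⟩
  have := h (y := i.h) (by simpa [abs_of_nonneg i.h_nonneg] using hi) i rfl
  rwa [norm_norm] at this

/-- Integration raises the order: a curve `q` that satisfies the differential equation up to a
defect of order `h ^ k` is close to the solution to order `h ^ (k + 1)`. The first hypothesis
says that the curve does not depend on the step size. -/
theorem isO_sub_of_isO_defect {k : ℕ} {q q' : ∀ i : StepProblem.{u} K R B ρ, ℝ → i.X}
    (hinv : ∀ i σ hσ, q' (i.restrict σ hσ) σ = q' i σ)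
    (h0 : ∀ i, q i 0 = i.x) (hq : ∀ i s, HasDerivAt (q i) (q' i s) s)
    (hd : IsO k fun i => -(i.M (i.z i.h)) + i.f (i.z i.h) - q' i i.h) :
    IsO (k + 1) fun i => i.z i.h - q i i.h := by
  obtain ⟨C, ε, hC, hε, hb⟩ := exists_bound hd
  refine Asymptotics.IsBigO.of_bound C ?_
  filter_upwards [eventually_h_lt hε] with i hi
  have hder : ∀ s ∈ Set.Icc 0 i.h, HasDerivWithinAt (fun s => i.z s - q i s)
      (-(i.M (i.z s)) + i.f (i.z s) - q' i s) (Set.Icc 0 i.h) s :=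
    fun s hs => (i.isSolutionOn s hs).sub (hq i s).hasDerivWithinAt
  have hbound : ∀ s ∈ Set.Ico 0 i.h,
      ‖-(i.M (i.z s)) + i.f (i.z s) - q' i s‖ ≤ C * i.h ^ k := by
    intro s hs
    have hs' := Set.Ico_subset_Icc_self hs
    have h1 := hb (i.restrict s hs') (hs.2.trans hi)
    change _ ≤ C * ‖s ^ k‖ at h1
    have h2 : ‖-(i.M (i.z s)) + i.f (i.z s) - q' i s‖ ≤ C * s ^ k := by
      rw [← hinv i s hs']
      exact (by rwa [Real.norm_of_nonneg (pow_nonneg hs.1 k)] at h1)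
    exact h2.trans (mul_le_mul_of_nonneg_left (pow_le_pow_left₀ hs.1 hs.2.le k) hC)
  have := norm_image_sub_le_of_norm_deriv_le_segment' hder hbound i.h i.h_mem_Icc
  rw [show i.z 0 - q i 0 = 0 by rw [h0]; exact sub_self _, sub_zero, sub_zero] at this
  rw [norm_norm, norm_pow, Real.norm_of_nonneg i.h_nonneg]
  exact this.trans (le_of_eq (by ring))

/-- The first derivative of the solution at the beginning of the step. -/
noncomputable def y₁ (i : StepProblem.{u} K R B ρ) : i.X := -(i.M i.x) + i.F

/-- The second derivative of the solution at the beginning of the step. -/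
noncomputable def y₂ (i : StepProblem.{u} K R B ρ) : i.X := -(i.M i.y₁) + i.J i.y₁

/-- The third derivative of the solution at the beginning of the step. -/
noncomputable def y₃ (i : StepProblem.{u} K R B ρ) : i.X :=
  -(i.M i.y₂) + (i.J i.y₂ + i.H i.y₁ i.y₁)

/-- The fourth derivative of the solution at the beginning of the step. -/
noncomputable def y₄ (i : StepProblem.{u} K R B ρ) : i.X :=
  -(i.M i.y₃) + (i.J i.y₃ + (3 : ℝ) • i.H i.y₁ i.y₂ + i.D i.y₁ i.y₁ i.y₁)

theorem bounded_y₁ : Bounded fun i : StepProblem.{u} K R B ρ => i.y₁ :=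
  (bounded_M.clm_apply_of_bounded bounded_x).neg.add bounded_F

theorem bounded_y₂ (hρ : 0 < ρ) : Bounded fun i : StepProblem.{u} K R B ρ => i.y₂ :=
  (bounded_M.clm_apply_of_bounded bounded_y₁).neg.add
    ((bounded_J hρ).clm_apply_of_bounded bounded_y₁)

theorem bounded_y₃ (hρ : 0 < ρ) : Bounded fun i : StepProblem.{u} K R B ρ => i.y₃ :=
  (bounded_M.clm_apply_of_bounded (bounded_y₂ hρ)).neg.add
    (((bounded_J hρ).clm_apply_of_bounded (bounded_y₂ hρ)).add
      (((bounded_H hρ).clm_apply_of_bounded bounded_y₁).clm_apply_of_bounded bounded_y₁))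

theorem hasDerivAt_quartic {X : Type*} [NormedAddCommGroup X] [NormedSpace ℝ X]
    (a₀ a₁ a₂ a₃ a₄ : X) (s : ℝ) :
    HasDerivAt (fun s : ℝ => a₀ + s • a₁ + (s ^ 2 / 2) • a₂ + (s ^ 3 / 6) • a₃ + (s ^ 4 / 24) • a₄)
      (a₁ + s • a₂ + (s ^ 2 / 2) • a₃ + (s ^ 3 / 6) • a₄) s := by
  have h := ((((((hasDerivAt_id s).smul_const a₁).const_add a₀).add
    (((hasDerivAt_pow 2 s).div_const 2).smul_const a₂)).add
    (((hasDerivAt_pow 3 s).div_const 6).smul_const a₃)).add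
    (((hasDerivAt_pow 4 s).div_const 24).smul_const a₄))
  refine HasDerivAt.congr_deriv h ?_
  simp only [Nat.add_one_sub_one, pow_one]
  push_cast
  module

theorem z_expansion_zero : IsO 1 fun i : StepProblem.{u} K R B ρ => i.z i.h - i.x := by
  have hMz : Bounded fun i : StepProblem.{u} K R B ρ => i.M (i.z i.h) :=
    bounded_M.clm_apply_of_bounded (Bounded.of_norm_le R fun i => i.norm_z_le _ i.h_mem_Icc)
  have hfz : Bounded fun i : StepProblem.{u} K R B ρ => i.f (i.z i.h) :=
    Bounded.of_norm_le B fun i => i.norm_f_z_le _ i.h_mem_Icc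
  refine isO_sub_of_isO_defect (k := 0) (q := fun i _ => i.x) (q' := fun i _ => 0)
    (fun _ _ _ => rfl) (fun _ => rfl) (fun i s => hasDerivAt_const s _) ?_
  simpa only [IsO, pow_zero, sub_zero] using hMz.neg.add hfz

theorem z_expansion_one (hρ : 0 < ρ) :
    IsO 2 fun i : StepProblem.{u} K R B ρ => i.z i.h - (i.x + i.h • i.y₁) := by
  refine isO_sub_of_isO_defect (k := 1) (q := fun i s => i.x + s • i.y₁) (q' := fun i _ => i.y₁)
    (fun _ _ _ => rfl) (fun i => by simp)
    (fun i s => by simpa using hasDerivAt_quartic i.x i.y₁ 0 0 0 s) ?_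
  refine ((bounded_M.clm_apply_of_bounded z_expansion_zero).neg.add
    (f_expansion_zero hρ z_expansion_zero)).congr fun i => ?_
  have e₁ : i.y₁ = -(i.M i.x) + i.F := rfl
  simp only [map_sub]
  linear_combination (norm := module) e₁

theorem z_expansion_two (hρ : 0 < ρ) :
    IsO 3 fun i : StepProblem.{u} K R B ρ =>
      i.z i.h - (i.x + i.h • i.y₁ + (i.h ^ 2 / 2) • i.y₂) := by
  refine isO_sub_of_isO_defect (k := 2) (q := fun i s => i.x + s • i.y₁ + (s ^ 2 / 2) • i.y₂)
    (q' := fun i s => i.y₁ + s • i.y₂) (fun _ _ _ => rfl) (fun i => by simp)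
    (fun i s => by simpa using hasDerivAt_quartic i.x i.y₁ i.y₂ 0 0 s) ?_
  refine ((bounded_M.clm_apply_of_bounded (z_expansion_one hρ)).neg.add
    (f_expansion_one hρ bounded_y₁ (z_expansion_one hρ))).congr fun i => ?_
  have e₁ : i.y₁ = -(i.M i.x) + i.F := rfl
  have e₂ : i.y₂ = -(i.M i.y₁) + i.J i.y₁ := rfl
  simp only [map_sub, map_add, map_smul]
  linear_combination (norm := module) e₁ + i.h • e₂

theorem z_expansion_three (hρ : 0 < ρ) :
    IsO 4 fun i : StepProblem.{u} K R B ρ =>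
      i.z i.h - (i.x + i.h • i.y₁ + (i.h ^ 2 / 2) • i.y₂ + (i.h ^ 3 / 6) • i.y₃) := by
  refine isO_sub_of_isO_defect (k := 3)
    (q := fun i s => i.x + s • i.y₁ + (s ^ 2 / 2) • i.y₂ + (s ^ 3 / 6) • i.y₃)
    (q' := fun i s => i.y₁ + s • i.y₂ + (s ^ 2 / 2) • i.y₃) (fun _ _ _ => rfl) (fun i => by simp)
    (fun i s => by simpa using hasDerivAt_quartic i.x i.y₁ i.y₂ i.y₃ 0 s) ?_
  have hz := z_expansion_two (K := K) (R := R) (B := B) hρ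
  have hf := f_expansion_two hρ bounded_y₁ ((bounded_y₂ hρ).const_smul (1 / 2))
    (hz.congr fun i => by module)
  refine ((bounded_M.clm_apply_of_bounded hz).neg.add hf).congr fun i => ?_
  have e₁ : i.y₁ = -(i.M i.x) + i.F := rfl
  have e₂ : i.y₂ = -(i.M i.y₁) + i.J i.y₁ := rfl
  have e₃ : i.y₃ = -(i.M i.y₂) + (i.J i.y₂ + i.H i.y₁ i.y₁) := rfl
  simp only [map_sub, map_add, map_smul]
  linear_combination (norm := module) e₁ + i.h • e₂ + (i.h ^ 2 / 2) • e₃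

theorem z_expansion_four (hρ : 0 < ρ) :
    IsO 5 fun i : StepProblem.{u} K R B ρ =>
      i.z i.h - (i.x + i.h • i.y₁ + (i.h ^ 2 / 2) • i.y₂ + (i.h ^ 3 / 6) • i.y₃
        + (i.h ^ 4 / 24) • i.y₄) := by
  refine isO_sub_of_isO_defect (k := 4)
    (q := fun i s => i.x + s • i.y₁ + (s ^ 2 / 2) • i.y₂ + (s ^ 3 / 6) • i.y₃ + (s ^ 4 / 24) • i.y₄)
    (q' := fun i s => i.y₁ + s • i.y₂ + (s ^ 2 / 2) • i.y₃ + (s ^ 3 / 6) • i.y₄)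
    (fun _ _ _ => rfl) (fun i => by simp)
    (fun i s => hasDerivAt_quartic i.x i.y₁ i.y₂ i.y₃ i.y₄ s) ?_
  have hz := z_expansion_three (K := K) (R := R) (B := B) hρ
  have hf := f_expansion_three hρ bounded_y₁ ((bounded_y₂ hρ).const_smul (1 / 2))
    ((bounded_y₃ hρ).const_smul (1 / 6)) (hz.congr fun i => by module)
  refine ((bounded_M.clm_apply_of_bounded hz).neg.add hf).congr fun i => ?_
  have e₁ : i.y₁ = -(i.M i.x) + i.F := rfl
  have e₂ : i.y₂ = -(i.M i.y₁) + i.J i.y₁ := rfl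
  have e₃ : i.y₃ = -(i.M i.y₂) + (i.J i.y₂ + i.H i.y₁ i.y₁) := rfl
  have e₄ : i.y₄ = -(i.M i.y₃) + (i.J i.y₃ + (3 : ℝ) • i.H i.y₁ i.y₂ + i.D i.y₁ i.y₁ i.y₁) := rfl
  simp only [map_sub, map_add, map_smul]
  linear_combination (norm := module) e₁ + i.h • e₂ + (i.h ^ 2 / 2) • e₃ + (i.h ^ 3 / 6) • e₄

/-! ### The exponential -/

theorem norm_expNeg_sub_sum_le (i : StepProblem.{u} K R B ρ) (c : ℝ) {n : ℕ} (hn : n ≠ 0)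
    (hi : i.h ≤ 1) :
    ‖expNeg i.M (c * i.h) - ∑ k ∈ Finset.range n, ((k.factorial : ℝ)⁻¹) • (-(c * i.h) • i.M) ^ k‖
      ≤ (|c| * K) ^ n * Real.exp (|c| * K) * i.h ^ n := by
  have hK : 0 ≤ K := (norm_nonneg _).trans i.norm_M_le
  have h1 : ‖-(c * i.h) • i.M‖ ≤ (|c| * K) * i.h := by
    rw [norm_smul, norm_neg, norm_mul, Real.norm_eq_abs, Real.norm_of_nonneg i.h_nonneg]
    calc |c| * i.h * ‖i.M‖ ≤ |c| * i.h * K :=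
          mul_le_mul_of_nonneg_left i.norm_M_le (mul_nonneg (abs_nonneg _) i.h_nonneg)
      _ = _ := by ring
  have h2 : |c| * K * i.h ≤ |c| * K := mul_le_of_le_one_right (by positivity) hi
  refine (norm_normedSpaceExp_sub_sum_le _ hn).trans ?_
  calc ‖-(c * i.h) • i.M‖ ^ n * Real.exp ‖-(c * i.h) • i.M‖
      ≤ (|c| * K * i.h) ^ n * Real.exp (|c| * K) :=
        mul_le_mul (pow_le_pow_left₀ (norm_nonneg _) h1 n) (Real.exp_le_exp.2 (h1.trans h2))
          (Real.exp_pos _).le (pow_nonneg (mul_nonneg (by positivity) i.h_nonneg) n)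
    _ = _ := by ring

theorem expNeg_expansion (c : ℝ) {n : ℕ} (hn : n ≠ 0) :
    IsO n fun i : StepProblem.{u} K R B ρ => expNeg i.M (c * i.h)
      - ∑ k ∈ Finset.range n, ((k.factorial : ℝ)⁻¹) • (-(c * i.h) • i.M) ^ k := by
  refine Asymptotics.IsBigO.of_bound ((|c| * K) ^ n * Real.exp (|c| * K)) ?_
  filter_upwards [eventually_h_lt one_pos] with i hi
  rw [norm_norm, norm_pow, Real.norm_of_nonneg i.h_nonneg]
  exact i.norm_expNeg_sub_sum_le c hn hi.le

theorem expNeg_sub_one (c : ℝ) :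
    IsO 1 fun i : StepProblem.{u} K R B ρ => expNeg i.M (c * i.h) - 1 := by
  simpa using expNeg_expansion (K := K) (R := R) (B := B) (ρ := ρ) c one_ne_zero

theorem bounded_expNeg (c : ℝ) :
    Bounded fun i : StepProblem.{u} K R B ρ => expNeg i.M (c * i.h) := by
  have h1 : Bounded fun i : StepProblem.{u} K R B ρ => (1 : i.X →L[ℝ] i.X) :=
    Bounded.of_norm_le 1 fun _ => ContinuousLinearMap.norm_id_le
  exact ((expNeg_sub_one c).bounded.add h1).congr fun i => sub_add_cancel _ _

theorem expNeg_apply_expansion_three (c : ℝ) :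
    IsO 4 fun i : StepProblem.{u} K R B ρ => expNeg i.M (c * i.h) i.x
      - (i.x - (c * i.h) • i.M i.x + ((c * i.h) ^ 2 / 2) • i.M (i.M i.x)
        - ((c * i.h) ^ 3 / 6) • i.M (i.M (i.M i.x))) := by
  refine ((expNeg_expansion c (n := 4) (by norm_num)).clm_apply_bounded bounded_x).congr
    fun i => ?_
  simp only [Finset.sum_range_succ, Finset.sum_range_zero, Nat.factorial, smul_pow, pow_succ,
    pow_zero, one_mul, zero_add, sub_apply, add_apply, smul_apply,
    one_apply_eq_self, mul_apply_eq_comp]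
  push_cast
  module

theorem expNeg_apply_expansion_four :
    IsO 5 fun i : StepProblem.{u} K R B ρ => expNeg i.M i.h i.x
      - (i.x - i.h • i.M i.x + (i.h ^ 2 / 2) • i.M (i.M i.x)
        - (i.h ^ 3 / 6) • i.M (i.M (i.M i.x)) + (i.h ^ 4 / 24) • i.M (i.M (i.M (i.M i.x)))) := by
  refine ((expNeg_expansion 1 (n := 5) (by norm_num)).clm_apply_bounded bounded_x).congr
    fun i => ?_
  simp only [Finset.sum_range_succ, Finset.sum_range_zero, Nat.factorial, smul_pow, pow_succ,
    pow_zero, one_mul, zero_add, sub_apply, add_apply, smul_apply,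
    one_apply_eq_self, mul_apply_eq_comp]
  push_cast
  module

/-! ### Expansion of the stages and the local error -/

/-- The expansion to second order of the nonlinearity at a stage with node `c`. Here
`α = ∑ a_j c_j` for the row of coefficients of the stage. -/
noncomputable def stageLow (i : StepProblem.{u} K R B ρ) (c α : ℝ) : i.X :=
  i.F + i.h • (c • i.J i.y₁)
    + i.h ^ 2 • ((c ^ 2 / 2) • i.J (i.M (i.M i.x)) + α • i.J (i.J i.y₁)
      + (c ^ 2 / 2) • i.H i.y₁ i.y₁)

/-- The coefficient of `h³` in the expansion of the nonlinearity at a stage. Its parameters are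
those of the `h³` term of the stage itself. -/
noncomputable def stageTop (i : StepProblem.{u} K R B ρ) (c α β₁ β₂ β₃ : ℝ) : i.X :=
  -((c ^ 3 / 6) • i.J (i.M (i.M (i.M i.x)))) + β₁ • i.J (i.J (i.M (i.M i.x)))
    + β₂ • i.J (i.J (i.J i.y₁)) + β₃ • i.J (i.H i.y₁ i.y₁)
    + (c ^ 3 / 2) • i.H i.y₁ (i.M (i.M i.x)) + (c * α) • i.H i.y₁ (i.J i.y₁)
    + (c ^ 3 / 6) • i.D i.y₁ i.y₁ i.y₁

/-- The common form of the expansions of all stages to third order. -/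
noncomputable def stagePolynomial (i : StepProblem.{u} K R B ρ) (c α β₁ β₂ β₃ : ℝ) : i.X :=
  i.x + i.h • (c • i.y₁) + i.h ^ 2 • ((c ^ 2 / 2) • i.M (i.M i.x) + α • i.J i.y₁)
    + i.h ^ 3 • (-((c ^ 3 / 6) • i.M (i.M (i.M i.x))) + β₁ • i.J (i.M (i.M i.x))
      + β₂ • i.J (i.J i.y₁) + β₃ • i.H i.y₁ i.y₁)

section

variable {u : ∀ i : StepProblem.{u} K R B ρ, i.X} {c α β₁ β₂ β₃ : ℝ}

theorem f_stage_expansion_three (hρ : 0 < ρ)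
    (hu : IsO 4 fun i => u i - i.stagePolynomial c α β₁ β₂ β₃) :
    IsO 4 fun i => i.f (u i) - (i.stageLow c α + i.h ^ 3 • i.stageTop c α β₁ β₂ β₃) := by
  have hM := bounded_M (K := K) (R := R) (B := B) (ρ := ρ)
  have hJ := bounded_J (K := K) (R := R) (B := B) hρ
  have hH := bounded_H (K := K) (R := R) (B := B) hρ
  have hMM := hM.clm_apply_of_bounded (hM.clm_apply_of_bounded bounded_x)
  have hJy := hJ.clm_apply_of_bounded bounded_y₁
  refine (f_expansion_three hρ (bounded_y₁.const_smul c)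
    ((hMM.const_smul (c ^ 2 / 2)).add (hJy.const_smul α))
    (((((hM.clm_apply_of_bounded hMM).const_smul (c ^ 3 / 6)).neg.add
      ((hJ.clm_apply_of_bounded hMM).const_smul β₁)).add
      ((hJ.clm_apply_of_bounded hJy).const_smul β₂)).add
      (((hH.clm_apply_of_bounded bounded_y₁).clm_apply_of_bounded bounded_y₁).const_smul β₃))
    hu).congr fun i => ?_
  simp only [stageLow, stageTop, map_add, map_neg, map_smul, smul_apply]
  module

set_option maxSynthPendingDepth 3 in
theorem bounded_stageTop (hρ : 0 < ρ) :
    Bounded fun i : StepProblem.{u} K R B ρ => i.stageTop c α β₁ β₂ β₃ := by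
  have hM := bounded_M (K := K) (R := R) (B := B) (ρ := ρ)
  have hJ := bounded_J (K := K) (R := R) (B := B) hρ
  have hy := bounded_y₁ (K := K) (R := R) (B := B) (ρ := ρ)
  have hHy := (bounded_H hρ).clm_apply_of_bounded hy
  have hMM := hM.clm_apply_of_bounded (hM.clm_apply_of_bounded bounded_x)
  have hJy := hJ.clm_apply_of_bounded hy
  exact ((((((((hJ.clm_apply_of_bounded (hM.clm_apply_of_bounded hMM)).const_smul _).neg.add
    ((hJ.clm_apply_of_bounded (hJ.clm_apply_of_bounded hMM)).const_smul _))).add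
    ((hJ.clm_apply_of_bounded (hJ.clm_apply_of_bounded hJy)).const_smul _)).add
    ((hJ.clm_apply_of_bounded (hHy.clm_apply_of_bounded hy)).const_smul _)).add
    ((hHy.clm_apply_of_bounded hMM).const_smul _)).add
    ((hHy.clm_apply_of_bounded hJy).const_smul _)).add
    (((((bounded_D hρ).clm_apply_of_bounded hy).clm_apply_of_bounded hy).clm_apply_of_bounded
      hy).const_smul _)

theorem f_stage_expansion_two (hρ : 0 < ρ)
    (hu : IsO 4 fun i => u i - i.stagePolynomial c α β₁ β₂ β₃) :
    IsO 3 fun i => i.f (u i) - i.stageLow c α :=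
  (((f_stage_expansion_three hρ hu).mono (by norm_num)).add
    (Bounded.pow_smul 3 (bounded_stageTop hρ))).congr fun i => by abel

end

variable (m : SVERK4)

theorem stage2_expansion :
    IsO 4 fun i : StepProblem.{u} K R B ρ => m.stage2 i.M i.f i.h i.x
      - i.stagePolynomial m.c2 0 0 0 0 := by
  refine (expNeg_apply_expansion_three m.c2).congr fun i => ?_
  have e₁ : i.y₁ = -(i.M i.x) + i.F := rfl
  simp only [SVERK4.stage2, stagePolynomial, SVERK4.c2]
  linear_combination (norm := module) (m.a21 * i.h) • e₁

theorem stage3_expansion (hρ : 0 < ρ) :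
    IsO 4 fun i : StepProblem.{u} K R B ρ => m.stage3 i.M i.f i.h i.x
      - i.stagePolynomial m.c3 (m.a32 * m.c2) (m.a32 * (m.c2 ^ 2 / 2)) 0
        (m.a32 * (m.c2 ^ 2 / 2)) := by
  refine ((expNeg_apply_expansion_three m.c3).add (IsO.h_smul
    ((f_stage_expansion_two hρ (stage2_expansion m)).const_smul m.a32))).congr fun i => ?_
  have e₁ : i.y₁ = -(i.M i.x) + i.F := rfl
  simp only [SVERK4.stage3, stagePolynomial, stageLow, SVERK4.c3]
  linear_combination (norm := module) ((m.a31 + m.a32) * i.h) • e₁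

theorem stage4_expansion (hρ : 0 < ρ) :
    IsO 4 fun i : StepProblem.{u} K R B ρ => m.stage4 i.M i.f i.h i.x
      - i.stagePolynomial m.c4 (m.a42 * m.c2 + m.a43 * m.c3)
        (m.a42 * (m.c2 ^ 2 / 2) + m.a43 * (m.c3 ^ 2 / 2)) (m.a43 * (m.a32 * m.c2))
        (m.a42 * (m.c2 ^ 2 / 2) + m.a43 * (m.c3 ^ 2 / 2)) := by
  refine (((expNeg_apply_expansion_three m.c4).add (IsO.h_smul
    ((f_stage_expansion_two hρ (stage2_expansion m)).const_smul m.a42))).add (IsO.h_smul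
    ((f_stage_expansion_two hρ (stage3_expansion m hρ)).const_smul m.a43))).congr fun i => ?_
  have e₁ : i.y₁ = -(i.M i.x) + i.F := rfl
  simp only [SVERK4.stage4, stagePolynomial, stageLow, SVERK4.c4]
  linear_combination (norm := module) ((m.a41 + m.a42 + m.a43) * i.h) • e₁

/-- The eight order conditions determine the weighted sum of the stage values up to order four. -/
theorem sum_stage_values (hm : m.OrderConditions) (i : StepProblem.{u} K R B ρ) :
    m.b1 • i.F + m.b2 • (i.stageLow m.c2 0 + i.h ^ 3 • i.stageTop m.c2 0 0 0 0)
      + m.b3 • (i.stageLow m.c3 (m.a32 * m.c2) + i.h ^ 3 • i.stageTop m.c3 (m.a32 * m.c2)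
        (m.a32 * (m.c2 ^ 2 / 2)) 0 (m.a32 * (m.c2 ^ 2 / 2)))
      + m.b4 • (i.stageLow m.c4 (m.a42 * m.c2 + m.a43 * m.c3)
        + i.h ^ 3 • i.stageTop m.c4 (m.a42 * m.c2 + m.a43 * m.c3)
          (m.a42 * (m.c2 ^ 2 / 2) + m.a43 * (m.c3 ^ 2 / 2)) (m.a43 * (m.a32 * m.c2))
          (m.a42 * (m.c2 ^ 2 / 2) + m.a43 * (m.c3 ^ 2 / 2)))
      = i.F + (i.h / 2) • i.J i.y₁
        + (i.h ^ 2 / 6) • (i.J (i.M (i.M i.x)) + i.J (i.J i.y₁) + i.H i.y₁ i.y₁)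
        + (i.h ^ 3 / 24) • (-(i.J (i.M (i.M (i.M i.x)))) + i.J (i.J (i.M (i.M i.x)))
          + i.J (i.J (i.J i.y₁)) + i.J (i.H i.y₁ i.y₁)
          + (3 : ℝ) • i.H i.y₁ (i.M (i.M i.x)) + (3 : ℝ) • i.H i.y₁ (i.J i.y₁)
          + i.D i.y₁ i.y₁ i.y₁) := by
  obtain ⟨h₁, h₂, h₃, h₄, h₅, h₆, h₇, h₈⟩ := hm
  simp only [stageLow, stageTop]
  linear_combination (norm := skip) h₁ • i.F + (i.h * h₂) • i.J i.y₁
    + (i.h ^ 2 / 2 * h₃) • i.J (i.M (i.M i.x)) + (i.h ^ 2 * h₄) • i.J (i.J i.y₁)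
    + (i.h ^ 2 / 2 * h₃) • i.H i.y₁ i.y₁
    - (i.h ^ 3 / 6 * h₅) • i.J (i.M (i.M (i.M i.x)))
    + (i.h ^ 3 / 2 * h₇) • i.J (i.J (i.M (i.M i.x)))
    + (i.h ^ 3 * h₈) • i.J (i.J (i.J i.y₁))
    + (i.h ^ 3 / 2 * h₇) • i.J (i.H i.y₁ i.y₁)
    + (i.h ^ 3 / 2 * h₅) • i.H i.y₁ (i.M (i.M i.x))
    + (i.h ^ 3 * h₆) • i.H i.y₁ (i.J i.y₁)
    + (i.h ^ 3 / 6 * h₅) • i.D i.y₁ i.y₁ i.y₁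
  module

/-- The correction term accounts for the part of the Taylor polynomial of the solution that mixes
`M` and the nonlinearity. -/
theorem expansion_add_sverkW4 (hρ : 0 < ρ) (i : StepProblem.{u} K R B ρ) :
    (i.x - i.h • i.M i.x + (i.h ^ 2 / 2) • i.M (i.M i.x)
        - (i.h ^ 3 / 6) • i.M (i.M (i.M i.x)) + (i.h ^ 4 / 24) • i.M (i.M (i.M (i.M i.x))))
      + i.h • (i.F + (i.h / 2) • i.J i.y₁
        + (i.h ^ 2 / 6) • (i.J (i.M (i.M i.x)) + i.J (i.J i.y₁) + i.H i.y₁ i.y₁)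
        + (i.h ^ 3 / 24) • (-(i.J (i.M (i.M (i.M i.x)))) + i.J (i.J (i.M (i.M i.x)))
          + i.J (i.J (i.J i.y₁)) + i.J (i.H i.y₁ i.y₁)
          + (3 : ℝ) • i.H i.y₁ (i.M (i.M i.x)) + (3 : ℝ) • i.H i.y₁ (i.J i.y₁)
          + i.D i.y₁ i.y₁ i.y₁))
      + sverkW4 i.M i.f i.h i.x
      = i.x + i.h • i.y₁ + (i.h ^ 2 / 2) • i.y₂ + (i.h ^ 3 / 6) • i.y₃
        + (i.h ^ 4 / 24) • i.y₄ := by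
  have hM : i.M i.y₁ = -(i.M (i.M i.x)) + i.M i.F := by
    rw [show i.y₁ = -(i.M i.x) + i.F from rfl, map_add, map_neg]
  have e₂ : i.y₂ = i.M (i.M i.x) - i.M i.F + i.J i.y₁ := by
    rw [show i.y₂ = -(i.M i.y₁) + i.J i.y₁ from rfl, hM]
    abel
  have e₃ : i.y₃ = -(i.M i.y₂) + (i.J i.y₂ + i.H i.y₁ i.y₁) := rfl
  have e₄ : i.y₄ = -(i.M i.y₃) + (i.J i.y₃ + (3 : ℝ) • i.H i.y₁ i.y₂ + i.D i.y₁ i.y₁ i.y₁) := rfl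
  have hW : sverkW4 i.M i.f i.h i.x = -((i.h ^ 2 / 2) • i.M i.F)
      + (i.h ^ 3 / 6) • (i.M (i.M i.F) - i.M (i.J i.y₁) - i.J (i.M i.F))
      + (i.h ^ 4 / 24) • (-(i.M (i.M (i.M i.F))) + i.M (i.M (i.J i.y₁)) - i.M (i.H i.y₁ i.y₁)
        - i.M (i.J (i.M (i.M i.x) - i.M i.F + i.J i.y₁)) + i.J (i.M (i.M i.F))
        - i.J (i.J (i.M i.F)) - i.J (i.M (i.J i.y₁))
        + (3 : ℝ) • i.H (-(i.M i.F)) i.y₁) := rfl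
  rw [hW, i.H_symm hρ (-(i.M i.F)), e₄, e₃, e₂]
  have e₁ : i.y₁ = -(i.M i.x) + i.F := rfl
  simp only [map_add, map_sub, map_neg]
  linear_combination (norm := module) -i.h • e₁

/-- The local error of one step is of order five. -/
theorem local_error (hm : m.OrderConditions) (hρ : 0 < ρ) :
    IsO 5 fun i : StepProblem.{u} K R B ρ => m.step i.M i.f i.h i.x - i.z i.h := by
  refine ((expNeg_apply_expansion_four.add (IsO.h_smul
    ((((f_stage_expansion_three hρ (stage2_expansion m)).const_smul m.b2).add
    ((f_stage_expansion_three hρ (stage3_expansion m hρ)).const_smul m.b3)).add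
    ((f_stage_expansion_three hρ (stage4_expansion m hρ)).const_smul m.b4)))).sub
    (z_expansion_four hρ)).congr fun i => ?_
  rw [← i.expansion_add_sverkW4 hρ, ← i.sum_stage_values m hm]
  simp only [SVERK4.step]
  module

/-! ### Stability of one step -/

theorem bounded_v : Bounded fun i : StepProblem.{u} K R B ρ => i.v := by
  have h : Bounded fun i : StepProblem.{u} K R B ρ => i.v - i.x :=
    Bounded.of_norm_le (ρ / 2) fun i => i.norm_v_sub_le
  exact (h.add bounded_x).congr fun i => sub_add_cancel _ _

theorem isBigO_pow_div (k : ℕ) (c : ℝ) :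
    (fun i : StepProblem.{u} K R B ρ => i.h ^ k / c) =O[small K R B ρ] fun _ => (1 : ℝ) :=
  ((tendsto_h.pow k).div_const c).isBigO_one ℝ

section Stages

variable {w u : ∀ i : StepProblem.{u} K R B ρ, i.X}

theorem eventually_mem_ball (hρ : 0 < ρ) (hw : ∀ i, ‖w i - i.x‖ ≤ ρ / 2)
    (hu : IsO 1 fun i => u i - w i) : ∀ᶠ i in small K R B ρ, u i ∈ Metric.ball i.x ρ := by
  filter_upwards [hu.eventually_norm_lt (by simpa using tendsto_h) (half_pos hρ)] with i hi
  rw [mem_ball_iff_norm, ← sub_add_sub_cancel (u i) (w i)]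
  linarith [norm_add_le (u i - w i) (w i - i.x), hw i]

theorem bounded_f (hu : ∀ᶠ i in small K R B ρ, u i ∈ Metric.ball i.x ρ) :
    Bounded fun i => i.f (u i) := by
  refine Asymptotics.IsBigO.of_bound B ?_
  filter_upwards [hu] with i hi
  simpa using i.norm_f_le hi

theorem expNeg_apply_sub (c : ℝ) (hw : Bounded w) :
    IsO 1 fun i => expNeg i.M (c * i.h) (w i) - w i :=
  ((expNeg_sub_one c).clm_apply_bounded hw).congr fun i => by simp

variable (m : SVERK4)

theorem bounded_f_base (hρ : 0 < ρ) (hw : ∀ i, ‖w i - i.x‖ ≤ ρ / 2) :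
    Bounded fun i => i.f (w i) :=
  bounded_f (eventually_mem_ball hρ hw (isO_of_eventually_eq_zero 1 (by simp)))

theorem stage2_mem_ball (hρ : 0 < ρ) (hw : ∀ i, ‖w i - i.x‖ ≤ ρ / 2) (hb : Bounded w) :
    ∀ᶠ i in small K R B ρ, m.stage2 i.M i.f i.h (w i) ∈ Metric.ball i.x ρ := by
  refine eventually_mem_ball hρ hw (((expNeg_apply_sub m.c2 hb).add
    (Bounded.h_smul ((bounded_f_base hρ hw).const_smul m.a21))).congr fun i => ?_)
  simp only [SVERK4.stage2]
  abel

theorem stage3_mem_ball (hρ : 0 < ρ) (hw : ∀ i, ‖w i - i.x‖ ≤ ρ / 2) (hb : Bounded w) :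
    ∀ᶠ i in small K R B ρ, m.stage3 i.M i.f i.h (w i) ∈ Metric.ball i.x ρ := by
  refine eventually_mem_ball hρ hw (((expNeg_apply_sub m.c3 hb).add
    (Bounded.h_smul (((bounded_f_base hρ hw).const_smul m.a31).add
      ((bounded_f (stage2_mem_ball m hρ hw hb)).const_smul m.a32)))).congr fun i => ?_)
  simp only [SVERK4.stage3]
  abel

theorem stage4_mem_ball (hρ : 0 < ρ) (hw : ∀ i, ‖w i - i.x‖ ≤ ρ / 2) (hb : Bounded w) :
    ∀ᶠ i in small K R B ρ, m.stage4 i.M i.f i.h (w i) ∈ Metric.ball i.x ρ := by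
  refine eventually_mem_ball hρ hw (((expNeg_apply_sub m.c4 hb).add
    (Bounded.h_smul ((((bounded_f_base hρ hw).const_smul m.a41).add
      ((bounded_f (stage2_mem_ball m hρ hw hb)).const_smul m.a42)).add
      ((bounded_f (stage3_mem_ball m hρ hw hb)).const_smul m.a43)))).congr fun i => ?_)
  simp only [SVERK4.stage4]
  abel

end Stages

section Close

variable {g : StepProblem.{u} K R B ρ → ℝ} {a b : ∀ i : StepProblem.{u} K R B ρ, i.X}

/-- A map whose values and derivatives are bounded on the ball of radius `ρ` preserves closeness of
families in that ball, by the mean value inequality. -/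
theorem close_comp {E : StepProblem.{u} K R B ρ → Type*} [∀ i, NormedAddCommGroup (E i)]
    [∀ i, NormedSpace ℝ (E i)] {φ : ∀ i : StepProblem.{u} K R B ρ, i.X → E i}
    (hd : ∀ i, ∀ y ∈ Metric.ball i.x ρ, DifferentiableAt ℝ (φ i) y)
    (h0 : ∀ i, ∀ y ∈ Metric.ball i.x ρ, ‖φ i y‖ ≤ B)
    (h1 : ∀ i, ∀ y ∈ Metric.ball i.x ρ, ‖fderiv ℝ (φ i) y‖ ≤ B)
    (hab : UniformlyClose (small K R B ρ) g a b)
    (ha : ∀ᶠ i in small K R B ρ, a i ∈ Metric.ball i.x ρ)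
    (hb : ∀ᶠ i in small K R B ρ, b i ∈ Metric.ball i.x ρ) :
    UniformlyClose (small K R B ρ) g (fun i => φ i (a i)) (fun i => φ i (b i)) := by
  refine ⟨Asymptotics.IsBigO.of_bound B ?_, Asymptotics.IsBigO.of_bound B ?_,
    Asymptotics.IsBigO.trans (Asymptotics.IsBigO.of_bound B ?_) hab.diff⟩
  · filter_upwards [ha] with i hi
    simpa using h0 i _ hi
  · filter_upwards [hb] with i hi
    simpa using h0 i _ hi
  · filter_upwards [ha, hb] with i hi hi'
    rw [norm_norm, norm_norm]
    exact (convex_ball _ _).norm_image_sub_le_of_norm_fderiv_le (hd i) (h1 i) hi' hi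

theorem close_f (hab : UniformlyClose (small K R B ρ) g a b)
    (ha : ∀ᶠ i in small K R B ρ, a i ∈ Metric.ball i.x ρ)
    (hb : ∀ᶠ i in small K R B ρ, b i ∈ Metric.ball i.x ρ) :
    UniformlyClose (small K R B ρ) g (fun i => i.f (a i)) (fun i => i.f (b i)) :=
  close_comp (φ := fun i => i.f)
    (fun i y hy => (i.contDiffOn.contDiffAt (Metric.isOpen_ball.mem_nhds hy)).differentiableAt
      (by norm_num))
    (fun i _ hy => i.norm_f_le hy) (fun i _ hy => i.norm_fderiv_le hy) hab ha hb

theorem close_fderiv (hab : UniformlyClose (small K R B ρ) g a b)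
    (ha : ∀ᶠ i in small K R B ρ, a i ∈ Metric.ball i.x ρ)
    (hb : ∀ᶠ i in small K R B ρ, b i ∈ Metric.ball i.x ρ) :
    UniformlyClose (small K R B ρ) g (fun i => fderiv ℝ i.f (a i))
      (fun i => fderiv ℝ i.f (b i)) :=
  close_comp (φ := fun i => fderiv ℝ i.f)
    (fun i y hy => (((i.contDiffOn.contDiffAt (Metric.isOpen_ball.mem_nhds hy)).fderiv_right
      (m := 4) (by norm_num)).differentiableAt (by norm_num)))
    (fun i _ hy => i.norm_fderiv_le hy) (fun i _ hy => i.norm_fderiv_two_le hy) hab ha hb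

set_option maxSynthPendingDepth 3 in
theorem close_fderiv_two (hab : UniformlyClose (small K R B ρ) g a b)
    (ha : ∀ᶠ i in small K R B ρ, a i ∈ Metric.ball i.x ρ)
    (hb : ∀ᶠ i in small K R B ρ, b i ∈ Metric.ball i.x ρ) :
    UniformlyClose (small K R B ρ) g (fun i => fderiv ℝ (fderiv ℝ i.f) (a i))
      (fun i => fderiv ℝ (fderiv ℝ i.f) (b i)) :=
  close_comp (φ := fun i => fderiv ℝ (fderiv ℝ i.f))
    (fun i y hy => ((((i.contDiffOn.contDiffAt (Metric.isOpen_ball.mem_nhds hy)).fderiv_right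
      (m := 4) (by norm_num)).fderiv_right (m := 3) (by norm_num)).differentiableAt
        (by norm_num)))
    (fun i _ hy => i.norm_fderiv_two_le hy) (fun i _ hy => i.norm_fderiv_three_le hy) hab ha hb

/-- The correction term at `w`, divided by `h`. -/
noncomputable def w4Quotient (i : StepProblem.{u} K R B ρ) (w : i.X) : i.X :=
  let F : i.X := i.f w
  let J : i.X →L[ℝ] i.X := fderiv ℝ i.f w
  let H : i.X →L[ℝ] i.X →L[ℝ] i.X := fderiv ℝ (fderiv ℝ i.f) w
  let g : i.X := -(i.M w) + F;
  -((i.h ^ 1 / 2) • i.M F)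
    + (i.h ^ 2 / 6) • (i.M (i.M F) - i.M (J g) - J (i.M F))
    + (i.h ^ 3 / 24) •
      (-(i.M (i.M (i.M F))) + i.M (i.M (J g)) - i.M (H g g)
        - i.M (J (i.M (i.M w) - i.M F + J g))
        + J (i.M (i.M F)) - J (J (i.M F)) - J (i.M (J g)) + (3 : ℝ) • H (-(i.M F)) g)

theorem sverkW4_eq_smul (i : StepProblem.{u} K R B ρ) (w : i.X) :
    sverkW4 i.M i.f i.h w = i.h • i.w4Quotient w := by
  simp only [sverkW4, w4Quotient]
  module

theorem close_w4Quotient (hab : UniformlyClose (small K R B ρ) g a b)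
    (ha : ∀ᶠ i in small K R B ρ, a i ∈ Metric.ball i.x ρ)
    (hb : ∀ᶠ i in small K R B ρ, b i ∈ Metric.ball i.x ρ) :
    UniformlyClose (small K R B ρ) g (fun i => i.w4Quotient (a i))
      (fun i => i.w4Quotient (b i)) := by
  have hM : UniformlyClose (small K R B ρ) g (fun i => i.M) (fun i => i.M) := .const bounded_M
  have hF := close_f hab ha hb
  have hJ := close_fderiv hab ha hb
  have hH := close_fderiv_two hab ha hb
  have hg := (hM.clm_apply hab).neg.add hF
  have hMF := hM.clm_apply hF
  have hMMF := hM.clm_apply hMF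
  have hJg := hJ.clm_apply hg
  have hMJg := hM.clm_apply hJg
  exact ((hMF.smul (isBigO_pow_div 1 2)).neg.add (((hMMF.sub hMJg).sub
      (hJ.clm_apply hMF)).smul (isBigO_pow_div 2 6))).add
      (((((((((hM.clm_apply hMMF).neg.add (hM.clm_apply hMJg)).sub
        (hM.clm_apply ((hH.clm_apply hg).clm_apply hg))).sub
        (hM.clm_apply (hJ.clm_apply (((hM.clm_apply (hM.clm_apply hab)).sub hMF).add hJg)))).add
        (hJ.clm_apply hMMF)).sub (hJ.clm_apply (hJ.clm_apply hMF))).sub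
        (hJ.clm_apply hMJg)).add (((hH.clm_apply hMF.neg).clm_apply hg).smul
          (Asymptotics.isBigO_const_const (3 : ℝ) one_ne_zero _))).smul (isBigO_pow_div 3 24))

end Close

/-- One step of the scheme is a perturbation of the identity that is Lipschitz with a constant of
order `h`. -/
theorem step_sub_step (m : SVERK4) (hρ : 0 < ρ) :
    UniformBigO (small.{u} K R B ρ) (fun i => i.h * ‖i.v - i.x‖) fun i =>
      m.step i.M i.f i.h i.v - m.step i.M i.f i.h i.x - (i.v - i.x) := by
  have hv : ∀ i : StepProblem.{u} K R B ρ, ‖i.v - i.x‖ ≤ ρ / 2 := fun i => i.norm_v_sub_le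
  have hx : ∀ i : StepProblem.{u} K R B ρ, ‖i.x - i.x‖ ≤ ρ / 2 := fun i => by
    rw [sub_self, norm_zero]
    exact (half_pos hρ).le
  have hdiff : UniformBigO (small.{u} K R B ρ) (fun i => ‖i.v - i.x‖) fun i => i.v - i.x :=
    UniformBigO.of_le 1 (by simp)
  have h0 : UniformlyClose (small.{u} K R B ρ) (fun i => ‖i.v - i.x‖) (fun i => i.v)
      (fun i => i.x) := ⟨bounded_v, bounded_x, hdiff⟩
  have hexp : ∀ c : ℝ, UniformlyClose (small.{u} K R B ρ) (fun i => ‖i.v - i.x‖)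
      (fun i => expNeg i.M (c * i.h) i.v) (fun i => expNeg i.M (c * i.h) i.x) := fun c =>
    UniformlyClose.clm_apply (.const (bounded_expNeg c)) h0
  have hc : ∀ c : ℝ, (fun _ : StepProblem.{u} K R B ρ => c) =O[small.{u} K R B ρ]
      fun _ => (1 : ℝ) := fun c => Asymptotics.isBigO_const_const c one_ne_zero _
  have hh : (fun i : StepProblem.{u} K R B ρ => i.h) =O[small.{u} K R B ρ] fun _ => (1 : ℝ) := by
    simpa using isBigO_pow_div (K := K) (R := R) (B := B) (ρ := ρ) 1 1
  have mv := eventually_mem_ball (u := fun i => i.v) hρ hv (isO_of_eventually_eq_zero 1 (by simp))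
  have mx := eventually_mem_ball (u := fun i => i.x) hρ hx (isO_of_eventually_eq_zero 1 (by simp))
  have k1 := close_f h0 mv mx
  have s2 := (hexp m.c2).add (UniformlyClose.smul hh (k1.smul (hc m.a21)))
  have k2 := close_f s2 (stage2_mem_ball m hρ hv bounded_v) (stage2_mem_ball m hρ hx bounded_x)
  have s3 := (hexp m.c3).add (UniformlyClose.smul hh
    ((k1.smul (hc m.a31)).add (k2.smul (hc m.a32))))
  have k3 := close_f s3 (stage3_mem_ball m hρ hv bounded_v) (stage3_mem_ball m hρ hx bounded_x)
  have s4 := (hexp m.c4).add (UniformlyClose.smul hh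
    (((k1.smul (hc m.a41)).add (k2.smul (hc m.a42))).add (k3.smul (hc m.a43))))
  have k4 := close_f s4 (stage4_mem_ball m hρ hv bounded_v) (stage4_mem_ball m hρ hx bounded_x)
  have hsum := ((((k1.smul (hc m.b1)).add (k2.smul (hc m.b2))).add (k3.smul (hc m.b3))).add
    (k4.smul (hc m.b4))).add (close_w4Quotient h0 mv mx)
  have e1 := (expNeg_sub_one (K := K) (R := R) (B := B) (ρ := ρ) 1).clm_apply hdiff
  simp only [pow_one, one_mul] at e1
  refine (e1.add (UniformBigO.smul (Asymptotics.isBigO_refl _ _) hsum.diff)).congr fun i => ?_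
  simp only [SVERK4.step, SVERK4.stage2, SVERK4.stage3, SVERK4.stage4, sverkW4_eq_smul, sub_apply,
    one_apply_eq_self, map_sub]
  module

end StepProblem

/-! ### The global error -/

theorem StepProblem.one_step_error {m : SVERK4} (hm : m.OrderConditions) (K R B : ℝ) {ρ : ℝ}
    (hρ : 0 < ρ) :
    ∃ Λ C ε : ℝ, 0 ≤ Λ ∧ 0 ≤ C ∧ 0 < ε ∧ ∀ i : StepProblem.{u} K R B ρ, i.h < ε →
      ‖m.step i.M i.f i.h i.v - i.z i.h‖ ≤ (1 + Λ * i.h) * ‖i.v - i.z 0‖ + C * i.h ^ 5 := by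
  obtain ⟨C, ε₁, hC, hε₁, h₁⟩ := StepProblem.exists_bound
    (StepProblem.local_error.{u} (K := K) (R := R) (B := B) m hm hρ)
  obtain ⟨Λ, ε₂, hΛ, hε₂, h₂⟩ := StepProblem.exists_bound
    (StepProblem.step_sub_step.{u} (K := K) (R := R) (B := B) m hρ)
  refine ⟨Λ, C, min ε₁ ε₂, hΛ, hC, lt_min hε₁ hε₂, fun i hi => ?_⟩
  have e₁ := h₁ i (hi.trans_le (min_le_left _ _))
  have e₂ := h₂ i (hi.trans_le (min_le_right _ _))
  rw [Real.norm_of_nonneg (pow_nonneg i.h_nonneg 5)] at e₁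
  rw [Real.norm_of_nonneg (mul_nonneg i.h_nonneg (norm_nonneg _))] at e₂
  have hsplit : m.step i.M i.f i.h i.v - i.z i.h
      = (m.step i.M i.f i.h i.v - m.step i.M i.f i.h i.x - (i.v - i.x)) + (i.v - i.x)
        + (m.step i.M i.f i.h i.x - i.z i.h) := by abel
  rw [hsplit]
  refine (norm_add₃_le).trans ?_
  linarith

/-- The error accumulates to order four as long as the numerical solution stays in the strip, and
for small step sizes the error bound itself keeps it there. -/
theorem SVERK4.global_error {m : SVERK4} (hm : m.OrderConditions) (T K R B : ℝ) {ρ : ℝ}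
    (hρ : 0 < ρ) : ∃ C h₀ : ℝ, 0 < h₀ ∧
      ∀ (X : Type u) [NormedAddCommGroup X] [NormedSpace ℝ X] [CompleteSpace X]
        (M : X →L[ℝ] X) (f : X → X) (y : ℝ → X) (t₀ tₑ : ℝ),
        tₑ - t₀ = T → ‖M‖ ≤ K → IsSolutionOn M f y t₀ tₑ →
        (∀ t ∈ Set.Icc t₀ tₑ, ‖y t‖ ≤ R) → SmoothInStrip f y t₀ tₑ ρ B →
        ∀ (h : ℝ) (n : ℕ), 0 < h → h ≤ h₀ → (n : ℝ) ≤ (tₑ - t₀) / h →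
          ‖m.numSol M f h (y t₀) n - y (t₀ + n * h)‖ ≤ C * h ^ 4 := by
  obtain ⟨Λ, C, ε, hΛ, hC, hε, hstep⟩ := StepProblem.one_step_error.{u} hm K R B hρ
  set C₀ : ℝ := |T| * C * Real.exp (Λ * |T|) with hC₀
  have hC₀0 : 0 ≤ C₀ := by positivity
  refine ⟨C₀, min (ε / 2) (min 1 (ρ / (2 * (C₀ + 1)))), by positivity, ?_⟩
  intro X _ _ _ M f y t₀ tₑ hT hM hsol hR hsm h n hh hh₀ hn
  have hhε : h < ε := by linarith [hh₀.trans (min_le_left _ _)]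
  have hh1 : h ≤ 1 := (hh₀.trans (min_le_right _ _)).trans (min_le_left _ _)
  have hhρ : h ≤ ρ / (2 * (C₀ + 1)) := (hh₀.trans (min_le_right _ _)).trans (min_le_right _ _)
  have hsmall : C₀ * h ^ 4 ≤ ρ / 2 := by
    have h4 : h ^ 4 ≤ h := pow_le_of_le_one hh.le hh1 (by norm_num)
    rw [le_div_iff₀ (by positivity)] at hhρ
    nlinarith
  have hbound : ∀ k : ℕ, k * h ≤ T →
      k * h * (C * h ^ 4) * Real.exp (Λ * (k * h)) ≤ C₀ * h ^ 4 := by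
    intro k hk
    have hk' : k * h ≤ |T| := hk.trans (le_abs_self T)
    calc k * h * (C * h ^ 4) * Real.exp (Λ * (k * h))
        ≤ |T| * (C * h ^ 4) * Real.exp (Λ * |T|) := by gcongr
      _ = C₀ * h ^ 4 := by rw [hC₀]; ring
  have hmain : ∀ k : ℕ, k * h ≤ T → ‖m.numSol M f h (y t₀) k - y (t₀ + k * h)‖
      ≤ k * h * (C * h ^ 4) * Real.exp (Λ * (k * h)) := by
    intro k
    induction k with
    | zero => simp [SVERK4.numSol]
    | succ k ih =>
      intro hk
      push_cast at hk ⊢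
      have hk0 : (0 : ℝ) ≤ k * h := by positivity
      have hk1 : k * h ≤ T := by linarith
      have ih := ih hk1
      have hmem : ∀ s ∈ Set.Icc 0 h, t₀ + k * h + s ∈ Set.Icc t₀ tₑ := fun s hs =>
        ⟨by linarith [hs.1], by linarith [hs.2]⟩
      have hball : Metric.ball (y (t₀ + k * h + 0)) ρ
          ⊆ Metric.thickening ρ (y '' Set.Icc t₀ tₑ) :=
        Metric.ball_subset_thickening (Set.mem_image_of_mem y (hmem 0 ⟨le_rfl, hh.le⟩)) ρ
      have key : ‖m.step M f h (m.numSol M f h (y t₀) k) - y (t₀ + k * h + h)‖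
          ≤ (1 + Λ * h) * ‖m.numSol M f h (y t₀) k - y (t₀ + k * h + 0)‖ + C * h ^ 5 := hstep
        { X := X
          M := M
          f := f
          z := fun s => y (t₀ + k * h + s)
          v := m.numSol M f h (y t₀) k
          h := h
          h_nonneg := hh.le
          norm_M_le := hM
          isSolutionOn := fun s hs => by
            have h1 := hsol _ (hmem s hs)
            have h2 : HasDerivWithinAt (fun s : ℝ => t₀ + k * h + s) 1 (Set.Icc 0 h) s :=
              ((hasDerivAt_id s).const_add _).hasDerivWithinAt
            exact (h1.scomp s h2 hmem).congr_deriv (one_smul ℝ _)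
          norm_z_le := fun s hs => hR _ (hmem s hs)
          norm_f_z_le := fun s hs => by
            simpa using hsm.2 0 (by norm_num) _ (Metric.self_subset_thickening hρ _
              (Set.mem_image_of_mem y (hmem s hs)))
          contDiffOn := hsm.1.mono hball
          norm_iteratedFDeriv_le := fun p hp x hx => hsm.2 p hp x (hball hx)
          norm_v_sub_le := by
            rw [add_zero]
            exact ih.trans ((hbound k hk1).trans hsmall) } hhε
      rw [add_zero] at key
      rw [show t₀ + ((k : ℝ) + 1) * h = t₀ + k * h + h by ring]
      refine key.trans ?_
      have hexp : 1 + Λ * h ≤ Real.exp (Λ * h) := by linarith [Real.add_one_le_exp (Λ * h)]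
      have hexp' : 1 ≤ Real.exp (Λ * ((k + 1) * h)) := Real.one_le_exp (by positivity)
      calc (1 + Λ * h) * ‖m.numSol M f h (y t₀) k - y (t₀ + k * h)‖ + C * h ^ 5
          ≤ Real.exp (Λ * h) * (k * h * (C * h ^ 4) * Real.exp (Λ * (k * h)))
            + C * h ^ 5 * Real.exp (Λ * ((k + 1) * h)) := by
            refine add_le_add (mul_le_mul hexp ih (norm_nonneg _) (Real.exp_pos _).le) ?_
            exact le_mul_of_one_le_right (by positivity) hexp'
        _ = (k + 1) * h * (C * h ^ 4) * Real.exp (Λ * ((k + 1) * h)) := by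
            rw [show Λ * (((k : ℝ) + 1) * h) = Λ * h + Λ * (k * h) by ring, Real.exp_add]
            ring
  have hnT : n * h ≤ T := by rwa [le_div_iff₀ hh, hT] at hn
  exact (hmain n hnT).trans (hbound n hnT)

/-! ### Arbitrary step sizes for a globally smooth nonlinearity -/

section GloballySmooth

variable {X : Type*} [NormedAddCommGroup X] [NormedSpace ℝ X]

theorem exists_smoothInStrip {f : X → X} (hf : ContDiff ℝ 5 f) {y : ℝ → X} {t₀ tₑ : ℝ}
    (hy : ContinuousOn y (Set.Icc t₀ tₑ)) : ∃ ρ B : ℝ, 0 < ρ ∧ SmoothInStrip f y t₀ tₑ ρ B := by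
  have hK : IsCompact (y '' Set.Icc t₀ tₑ) := isCompact_Icc.image_of_continuousOn hy
  set φ : X → ℝ := fun x => ∑ p ∈ Finset.range 6, ‖iteratedFDeriv ℝ p f x‖ with hφ
  have hφc : Continuous φ := continuous_finsetSum _ fun p hp =>
    (hf.continuous_iteratedFDeriv (by
      have : p ≤ 5 := by simpa [Nat.lt_succ_iff] using hp
      exact_mod_cast this)).norm
  obtain ⟨B, hB⟩ := hK.exists_bound_of_continuousOn hφc.continuousOn
  obtain ⟨ρ, hρ, hsub⟩ := hK.exists_thickening_subset_open
    (isOpen_lt hφc (continuous_const (y := B + 1)))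
    (fun x hx => by
      have := (Real.le_norm_self _).trans (hB x hx)
      show φ x < B + 1
      linarith)
  refine ⟨ρ, B + 1, hρ, hf.contDiffOn, fun p hp x hx => ?_⟩
  have h1 : φ x < B + 1 := hsub hx
  refine le_trans ?_ h1.le
  exact Finset.single_le_sum (f := fun p => ‖iteratedFDeriv ℝ p f x‖)
    (fun _ _ => norm_nonneg _) (Finset.mem_range.2 (by omega))

theorem continuous_expNeg_apply [CompleteSpace X] (M : X →L[ℝ] X) {α : Type*} [TopologicalSpace α]
    {t : α → ℝ} {x : α → X} (ht : Continuous t) (hx : Continuous x) :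
    Continuous fun a => expNeg M (t a) (x a) := by
  let _ : NormedAlgebra ℚ (X →L[ℝ] X) := NormedAlgebra.restrictScalars ℚ ℝ (X →L[ℝ] X)
  have h : Continuous fun a => expNeg M (t a) :=
    NormedSpace.exp_continuous.comp (ht.neg.smul continuous_const)
  exact h.clm_apply hx

theorem SVERK4.continuous_numSol [CompleteSpace X] (m : SVERK4) (M : X →L[ℝ] X) {f : X → X}
    (hf : ContDiff ℝ 5 f) (y₀ : X) (n : ℕ) : Continuous fun h => m.numSol M f h y₀ n := by
  have hf₀ := hf.continuous
  have hf₁ : ContDiff ℝ 4 (fderiv ℝ f) := hf.fderiv_right (by norm_num)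
  have hf₂ : Continuous (fderiv ℝ (fderiv ℝ f)) := hf₁.continuous_fderiv (by norm_num)
  have hf₁ := hf₁.continuous
  induction n with
  | zero => exact continuous_const
  | succ n ih =>
    have e := fun c : ℝ => continuous_expNeg_apply M (continuous_const_mul c) ih
    have e₁ := continuous_expNeg_apply M continuous_id ih
    have s₂ : Continuous fun h => m.stage2 M f h (m.numSol M f h y₀ n) := by
      have := e m.c2
      simp only [SVERK4.stage2]
      fun_prop
    have s₃ : Continuous fun h => m.stage3 M f h (m.numSol M f h y₀ n) := by
      have := e m.c3
      simp only [SVERK4.stage3]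
      fun_prop
    have s₄ : Continuous fun h => m.stage4 M f h (m.numSol M f h y₀ n) := by
      have := e m.c4
      simp only [SVERK4.stage4]
      fun_prop
    have w : Continuous fun h => sverkW4 M f h (m.numSol M f h y₀ n) := by
      simp only [sverkW4]
      fun_prop
    simp only [SVERK4.numSol, SVERK4.step]
    fun_prop

end GloballySmooth

theorem mainTheorem1 (m : SVERK4) (hm : m.OrderConditions) :
    (∀ T K L ρ R B : ℝ, 0 < ρ → ∃ C h₀ : ℝ, 0 < h₀ ∧
      ∀ (X : Type u) [NormedAddCommGroup X] [NormedSpace ℝ X] [CompleteSpace X]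
        (M : X →L[ℝ] X) (f : X → X) (y : ℝ → X) (t₀ tₑ : ℝ),
        tₑ - t₀ = T → ‖M‖ ≤ K → IsSolutionOn M f y t₀ tₑ →
        (∀ t ∈ Set.Icc t₀ tₑ, ‖y t‖ ≤ R) →
        LipschitzInStrip f y t₀ tₑ ρ L → SmoothInStrip f y t₀ tₑ ρ B →
        ∀ (h : ℝ) (n : ℕ), 0 < h → h ≤ h₀ → 1 ≤ n → (n : ℝ) ≤ (tₑ - t₀) / h →
          ‖m.numSol M f h (y t₀) n - y (t₀ + n * h)‖ ≤ C * h ^ 4) ∧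
    (∀ (X : Type u) [NormedAddCommGroup X] [NormedSpace ℝ X] [CompleteSpace X]
      (M : X →L[ℝ] X) (f : X → X) (y : ℝ → X) (t₀ tₑ : ℝ),
      ContDiff ℝ 5 f → IsSolutionOn M f y t₀ tₑ →
      ∃ C : ℝ, ∀ (h : ℝ) (n : ℕ), 0 < h → 1 ≤ n → (n : ℝ) ≤ (tₑ - t₀) / h →
        ‖m.numSol M f h (y t₀) n - y (t₀ + n * h)‖ ≤ C * h ^ 4) := by
  constructor
  · intro T K L ρ R B hρ
    obtain ⟨C, h₀, hh₀, hC⟩ := SVERK4.global_error.{u} hm T K R B hρ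
    exact ⟨C, h₀, hh₀, fun X _ _ _ M f y t₀ tₑ hT hM hsol hR _ hsm h n hh hle _ hn =>
      hC X M f y t₀ tₑ hT hM hsol hR hsm h n hh hle hn⟩
  · intro X _ _ _ M f y t₀ tₑ hf hsol
    have hy : ContinuousOn y (Set.Icc t₀ tₑ) := fun t ht => (hsol t ht).continuousWithinAt
    obtain ⟨ρ, B, hρ, hsm⟩ := exists_smoothInStrip hf hy
    obtain ⟨R, hR⟩ := isCompact_Icc.exists_bound_of_continuousOn hy
    obtain ⟨C, h₀, hh₀, hC⟩ := SVERK4.global_error.{u} hm (tₑ - t₀) ‖M‖ R B hρ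
    choose D hD using fun n : ℕ =>
      (isCompact_Icc (a := h₀) (b := tₑ - t₀)).exists_bound_of_continuousOn
        (m.continuous_numSol M hf (y t₀) n).continuousOn
    -- Steps longer than `h₀` are at most `N` in number.
    set N : ℕ := ⌊(tₑ - t₀) / h₀⌋₊ with hN
    set D₀ : ℝ := ∑ n ∈ Finset.range (N + 1), |D n| + |R| with hD₀
    have hD₀0 : 0 ≤ D₀ := by positivity
    refine ⟨max C (D₀ / h₀ ^ 4), fun h n hh hn1 hn => ?_⟩
    have hnh : n * h ≤ tₑ - t₀ := by rwa [le_div_iff₀ hh] at hn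
    rcases le_or_gt h h₀ with hle | hgt
    · refine (hC X M f y t₀ tₑ rfl le_rfl hsol hR hsm h n hh hle hn).trans ?_
      gcongr
      exact le_max_left _ _
    · have h1n : (1 : ℝ) ≤ n := by exact_mod_cast hn1
      have hnN : n ≤ N := by
        refine Nat.le_floor ((le_div_iff₀ hh₀).2 (le_trans ?_ hnh))
        gcongr
      have e₁ : ‖m.numSol M f h (y t₀) n‖ ≤ ∑ n ∈ Finset.range (N + 1), |D n| := by
        refine (hD n h ⟨hgt.le, by nlinarith⟩).trans ((le_abs_self _).trans ?_)
        exact Finset.single_le_sum (f := fun n => |D n|) (fun _ _ => abs_nonneg _)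
          (Finset.mem_range.2 (by omega))
      have e₂ : ‖y (t₀ + n * h)‖ ≤ |R| :=
        (hR _ ⟨by linarith [mul_nonneg (zero_le_one.trans h1n) hh.le], by linarith⟩).trans
          (le_abs_self R)
      calc ‖m.numSol M f h (y t₀) n - y (t₀ + n * h)‖ ≤ D₀ :=
            (norm_sub_le _ _).trans (add_le_add e₁ e₂)
        _ = D₀ / h₀ ^ 4 * h₀ ^ 4 := by field_simp
        _ ≤ max C (D₀ / h₀ ^ 4) * h ^ 4 := by
            gcongr
            exact le_max_right _ _
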